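/- **Setting.** Let $(E,d)$ be a complete separable metric space. Let $A$ be an operator with domain $\mathcal D(A)\subset C_b(E)$ (bounded continuous real functions) and with values in the real-valued Borel functions on $E$. The bp-closure of a set of bounded Borel functions (or of pairs of such functions) is the smallest set of such functions (pairs) that contains it and is closed under bounded pointwise convergence of sequences. Assume: * **A1.** $\Phi:E\to[0,\infty)$ is Borel, and for every $f\in\mathcal D(A)$ there is a constant $C_f$ with $|Af(x)|\le C_f\Phi(x)$ for all $x\in E$. * **A2.** $\{f_j\}\subset\mathcal D(A)$ is a countable set such that the bp-closure of $\{(f_j,\Phi^{-1}Af_j)\}$ contains $(f,\Phi^{-1}Af)$ for every $f\in\mathcal D(A)$. (Here $\Phi^{-1}Af$ is read as $0$ where $\Phi=0$.) For a measurable $E$-valued process $X=(X_t)_{t\ge0}$ on a probability space $(\Omega,\mathcal F,\mathbb P)$ let ${}^*\mathcal F^X_t=\sigma\{X_u,\int_0^u h(X_s)\,ds: u\le t,\ h\in C_b(E)\}$. Call $X$ a solution to the $A$ martingale problem if it is measurable, $\mathbb E\int_0^T\Phi(X_s)\,ds<\infty$ for all $T<\infty$, and $f(X_t)-\int_0^tAf(X_s)\,ds$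 is a $({}^*\mathcal F^X_t)$-martingale for every $f\in\mathcal D(A)$. For $m\ge1$ let $\mathcal P(E^m)$ be the space of probability measures on $E^m$ with the weak topology, and let $\mathcal C_m=C([0,\infty)^m,\mathcal P(E^m))$ with uniform convergence on compact sets. Let $\mathcal S_m\subset\mathcal C_m$ be the set of $\mu^m$ such that, for all permutations $\pi$ of $\{1,\dots,m\}$, all $f\in C_b(E^m)$ and all $t_1,\dots,t_m\ge0$, $$\int f(x_{\pi1},\dots,x_{\pi m})\,\mu^m(t_1,\dots,t_m)(dx)=\int f(x_1,\dots,x_m)\,\mu^m(t_{\pi1},\dots,t_{\pi m})(dx).$$ Let $\tilde{\mathcal S}$ be the set of $\mu=(\mu^1,\mu^2,\dots)\in\prod_{m\ge1}\mathcal S_m$ (product topology) such that, for all $m\ge2$ and all times, the image of $\mu^m(t_1,\dots,t_m)$ under $(x_1,\dots,x_m)\mapsto(x_1,\dots,x_{m-1})$ is $\mu^{m-1}(t_1,\dots,t_{m-1})$, and $\mu^2(t,t)(\{(x,x):x\in E\})=1$ for all $t\ge0$. Call a set $\mathcal G\subset C_b(E)$ bp-dense in $C_b(E)$ if its bp-closure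 contains $C_b(E)$. For a countable bp-dense $\mathcal G\subset C_b(E)$ let $\mathcal M\subset\tilde{\mathcal S}$ be the set of $\mu\in\tilde{\mathcal S}$ with $$\int_0^N\int_E\Phi\,d\mu^1(s)\,ds<\infty\quad\text{for all integers } N\ge1,$$ $$\int G\otimes f_j\,d\mu^{k+1}(s_1,\dots,s_k,t)-\int G\otimes f_j\,d\mu^{k+1}(s_1,\dots,s_k,s)=\int_s^t\Big(\int G\otimes Af_j\,d\mu^{k+1}(s_1,\dots,s_k,u)\Big)du$$ for all $j$, all $k\ge1$, all $g_1,\dots,g_k\in\mathcal G$ and all nonnegative rationals $s_1,\dots,s_k,s,t$ with $s_i\le s\le t$, where $G\otimes h(x_1,\dots,x_k,z)=g_1(x_1)\cdots g_k(x_k)h(z)$. **Theorem.** Under A1 and A2, $\tilde{\mathcal S}$ is a Polish space, there exists a countable bp-dense set $\mathcal G\subset C_b(E)$, and for every such $\mathcal G$: 1. $\mathcal M$ is a Borel subset of $\tilde{\mathcal S}$; in particular $\mathcal M$, with its Borel $\sigma$-field, is a standard Borel space. 2. For $\mu\in\tilde{\mathcal S}$: $\mu\in\mathcal M$ if and only if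 there exists a process $X$ on some probability space that is continuous in probability, has finite dimensional distributions $\mathcal L(X_{t_1},\dots,X_{t_m})=\mu^m(t_1,\dots,t_m)$ for all $m\ge1$ and $t_1,\dots,t_m\ge0$, and is a solution to the $A$ martingale problem. 3. The finite dimensional distributions of every solution to the $A$ martingale problem that is continuous in probability form an element of $\mathcal M$. -/

import Mathlib

open MeasureTheory Filter Topology Set
open scoped NNReal ENNReal BoundedContinuousFunction

noncomputable section

/-- The bp-closure of a set `C` of bounded Borel functions `α → V`: the smallest set containing `C`
that is closed under bounded pointwise convergence of sequences. (Bounded pointwise limits of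
bounded Borel functions are again bounded and Borel, so when `C` consists of such functions this is
the same as the smallest such subset of the space of bounded Borel functions.) -/
def bpClosure {α V : Type*} [NormedAddCommGroup V] (C : Set (α → V)) : Set (α → V) :=
  ⋂₀ {S | C ⊆ S ∧ ∀ (u : ℕ → α → V) (v : α → V), (∀ n, u n ∈ S) →
    (∃ K : ℝ, ∀ n x, ‖u n x‖ ≤ K) → (∀ x, Tendsto (fun n => u n x) atTop (𝓝 (v x))) → v ∈ S}

/-- A set `𝒢` of bounded continuous functions is bp-dense in `C_b(E)`. -/
def IsBpDense {E : Type*} [TopologicalSpace E] (𝒢 : Set (E →ᵇ ℝ)) : Prop :=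
  ∀ h : E →ᵇ ℝ, (h : E → ℝ) ∈ bpClosure ((fun g : E →ᵇ ℝ => (g : E → ℝ)) '' 𝒢)

section Operator

variable {E : Type*} [TopologicalSpace E] {𝒟 : Set (E →ᵇ ℝ)}

/-- `|A f| ≤ C_f Φ` pointwise, for every `f` in the domain `𝒟` of the operator `A`. -/
def IsDominated (A : 𝒟 → E → ℝ) (Φ : E → ℝ≥0) : Prop :=
  ∀ f : 𝒟, ∃ C : ℝ, ∀ x, |A f x| ≤ C * Φ x

/-- The pair `(f, Φ⁻¹ A f)` as a function with values in `ℝ × ℝ`. Where `Φ` vanishes so does `A f`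
(if `A` is dominated by `Φ`), and `Φ⁻¹ A f` is read as `0` there. -/
def graphPair (A : 𝒟 → E → ℝ) (Φ : E → ℝ≥0) (f : 𝒟) : E → ℝ × ℝ :=
  fun x => ((f : E →ᵇ ℝ) x, (Φ x : ℝ)⁻¹ * A f x)

/-- The bp-closure of the pairs `(f, Φ⁻¹ A f)`, `f ∈ 𝒻`, contains all pairs `(f, Φ⁻¹ A f)`,
`f ∈ 𝒟`. -/
def IsBpGenerating (A : 𝒟 → E → ℝ) (Φ : E → ℝ≥0) (𝒻 : Set 𝒟) : Prop :=
  range (graphPair A Φ) ⊆ bpClosure (graphPair A Φ '' 𝒻)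

end Operator

section StochasticProcess

variable {E : Type*} [TopologicalSpace E] [MeasurableSpace E] [BorelSpace E]
variable {Ω : Type*} {mΩ : MeasurableSpace Ω}

/-- The σ-field `*ℱ^X_t` generated by `X_u` and `∫_0^u h(X_s) ds` for `u ≤ t`, `h ∈ C_b(E)`. -/
abbrev starSigma (X : ℝ≥0 → Ω → E) (t : ℝ≥0) : MeasurableSpace Ω :=
  ⨆ (u : ℝ≥0) (_ : u ≤ t),
    (MeasurableSpace.comap (X u) inferInstance ⊔
      ⨆ h : E →ᵇ ℝ, MeasurableSpace.comap
        (fun ω => ∫ s in (0 : ℝ)..u, h (X s.toNNReal ω)) inferInstance)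

/-- The filtration `(*ℱ^X_t)` of a measurable process `X`. -/
def starFiltration (X : ℝ≥0 → Ω → E) (hX : Measurable (Function.uncurry X)) :
    Filtration ℝ≥0 mΩ where
  seq := starSigma X
  mono' := fun _ _ hst => iSup₂_le fun u hu => le_iSup₂_of_le u (hu.trans hst) le_rfl
  le' := by
    intro t
    refine iSup₂_le fun u _ => sup_le ?_ (iSup_le fun h => ?_)
    · exact (hX.comp measurable_prodMk_left).comap_le
    · refine Measurable.comap_le ?_
      simp_rw [intervalIntegral.integral_of_le u.coe_nonneg]
      have hm : Measurable (fun p : Ω × ℝ => h (X p.2.toNNReal p.1)) :=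
        h.continuous.measurable.comp
          (hX.comp ((measurable_real_toNNReal.comp measurable_snd).prodMk measurable_fst))
      exact hm.stronglyMeasurable.integral_prod_right.measurable

/-- `X` is a solution to the martingale problem for `(A, ν)` on the probability space `(Ω, P)`. -/
structure IsSolutionWithInitialLaw {𝒟 : Set (E →ᵇ ℝ)} (A : 𝒟 → E → ℝ) (Φ : E → ℝ≥0)
    (ν : ProbabilityMeasure E) (P : Measure Ω) (X : ℝ≥0 → Ω → E) : Prop where
  measurable : Measurable (Function.uncurry X)
  initial_law : P.map (X 0) = (ν : Measure E)
  lintegral_lt_top : ∀ T : ℝ≥0,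
    ∫⁻ ω, (∫⁻ s in Ioc (0 : ℝ) T, (Φ (X s.toNNReal ω) : ℝ≥0∞)) ∂P < ∞
  martingale : ∀ f : 𝒟,
    Martingale (fun (t : ℝ≥0) ω => (f : E →ᵇ ℝ) (X t ω) - ∫ s in (0 : ℝ)..t, A f (X s.toNNReal ω))
      (starFiltration X measurable) P

/-- `X` is a solution to the `A` martingale problem. -/
def IsSolution {𝒟 : Set (E →ᵇ ℝ)} (A : 𝒟 → E → ℝ) (Φ : E → ℝ≥0)
    (P : Measure Ω) (X : ℝ≥0 → Ω → E) : Prop :=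
  ∃ ν : ProbabilityMeasure E, IsSolutionWithInitialLaw A Φ ν P X

/-- `t ↦ X_t` is continuous in probability on `[0, ∞)`. -/
def IsContinuousInProbability {E Ω : Type*} [EDist E] {_ : MeasurableSpace Ω}
    (P : Measure Ω) (X : ℝ≥0 → Ω → E) : Prop :=
  ∀ t : ℝ≥0, TendstoInMeasure P X (𝓝 t) (X t)

end StochasticProcess

section FddSpace

variable (E : Type*) [TopologicalSpace E] [SecondCountableTopology E]
  [MeasurableSpace E] [BorelSpace E]

/-- `C([0,∞)^n, 𝒫(E^n))`, with the topology of uniform convergence on compact sets (the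
compact-open topology), `𝒫(E^n)` carrying the topology of weak convergence. -/
abbrev LawMaps (n : ℕ) : Type _ :=
  C(Fin n → ℝ≥0, ProbabilityMeasure (Fin n → E))

/-- The elements of `C([0,∞)^n, 𝒫(E^n))` that are compatible with permutations of coordinates:
`∫ f(x_{π 1}, …, x_{π n}) μ(t_1, …, t_n)(dx) = ∫ f(x) μ(t_{π 1}, …, t_{π n})(dx)`. -/
def SymmetricLawMaps (n : ℕ) : Set (LawMaps E n) :=
  {μ | ∀ (π : Equiv.Perm (Fin n)) (f : (Fin n → E) →ᵇ ℝ) (t : Fin n → ℝ≥0),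
    ∫ x, f (fun i => x (π i)) ∂(μ t : Measure (Fin n → E)) =
      ∫ x, f x ∂(μ (fun i => t (π i)) : Measure (Fin n → E))}

/-- The product over `n ≥ 1` of the spaces of symmetric law maps, with the product topology.
The component with index `m` is the `(m+1)`-dimensional one: `μ m` is `μ^{m+1}`. -/
abbrev LawFamilies : Type _ := ∀ m : ℕ, SymmetricLawMaps E (m + 1)

/-- The space `S̃` of consistent continuous families of finite dimensional laws whose
two-dimensional laws at `(t, t)` are carried by the diagonal. -/
def ConsistentFamilies : Set (LawFamilies E) :=
  {μ | (∀ (m : ℕ) (t : Fin (m + 2) → ℝ≥0),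
      (((μ (m + 1)).1 t : Measure (Fin (m + 2) → E)).map
        (fun x (i : Fin (m + 1)) => x i.castSucc)) =
          ((μ m).1 (fun i : Fin (m + 1) => t i.castSucc) : Measure (Fin (m + 1) → E))) ∧
    ∀ t : ℝ≥0, ((μ 1).1 (fun _ => t) : Measure (Fin 2 → E)) {x | x 0 = x 1} = 1}

variable {E}

/-- `μ^n(t_1, …, t_n)` for `n = m + 1`, as a measure on `E^n`. -/
def lawAt (μ : ConsistentFamilies E) (m : ℕ) (t : Fin (m + 1) → ℝ≥0) :
    Measure (Fin (m + 1) → E) :=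
  ((μ.1 m).1 t : Measure (Fin (m + 1) → E))

/-- The finite dimensional distributions of `X` under `P` are given by `μ`. -/
def HasFiniteDimLaws {Ω : Type*} {_ : MeasurableSpace Ω} (P : Measure Ω) (X : ℝ≥0 → Ω → E)
    (μ : ConsistentFamilies E) : Prop :=
  ∀ (m : ℕ) (t : Fin (m + 1) → ℝ≥0), P.map (fun ω i => X (t i) ω) = lawAt μ m t

/-- `(g_1 ⊗ ⋯ ⊗ g_k ⊗ h)(x_1, …, x_k, z) = g_1(x_1) ⋯ g_k(x_k) h(z)`. -/
def tensorFun {k : ℕ} (g : Fin k → E →ᵇ ℝ) (h : E → ℝ) (x : Fin (k + 1) → E) : ℝ :=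
  (∏ i : Fin k, g i (x i.castSucc)) * h (x (Fin.last k))

/-- The vector of times `(s_1, …, s_k, u)`. -/
def times {k : ℕ} (r : Fin k → ℚ≥0) (u : ℝ≥0) : Fin (k + 1) → ℝ≥0 :=
  Fin.snoc (α := fun _ => ℝ≥0) (fun i => (r i : ℝ≥0)) u

/-- The set `ℳ ⊆ S̃` determined by the functions `𝒻` in the domain and the test functions `𝒢`:
`∫_0^N ⟨μ^1(s), Φ⟩ ds < ∞` for all `N`, and for all rationals `r_i ≤ s ≤ t`, all `g_i ∈ 𝒢` and
`f ∈ 𝒻`,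
`⟨μ^{k+1}(r, t), G ⊗ f⟩ - ⟨μ^{k+1}(r, s), G ⊗ f⟩ = ∫_s^t ⟨μ^{k+1}(r, u), G ⊗ A f⟩ du`. -/
def solutionLaws {𝒟 : Set (E →ᵇ ℝ)} (A : 𝒟 → E → ℝ) (Φ : E → ℝ≥0) (𝒻 : Set 𝒟)
    (𝒢 : Set (E →ᵇ ℝ)) : Set (ConsistentFamilies E) :=
  {μ | (∀ N : ℕ, ∫⁻ s in Ioc (0 : ℝ) N,
        ∫⁻ x, (Φ (x 0) : ℝ≥0∞) ∂(lawAt μ 0 (fun _ => s.toNNReal)) < ∞) ∧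
    ∀ (k : ℕ), 1 ≤ k → ∀ (g : Fin k → E →ᵇ ℝ), (∀ i, g i ∈ 𝒢) → ∀ f ∈ 𝒻,
      ∀ (r : Fin k → ℚ≥0) (s t : ℚ≥0), (∀ i, r i ≤ s) → s ≤ t →
        (∫ x, tensorFun g (f : E →ᵇ ℝ) x ∂(lawAt μ k (times r (t : ℝ≥0)))) -
          (∫ x, tensorFun g (f : E →ᵇ ℝ) x ∂(lawAt μ k (times r (s : ℝ≥0)))) =
        ∫ u in (s : ℝ)..(t : ℝ),
          ∫ x, tensorFun g (A f) x ∂(lawAt μ k (times r u.toNNReal))}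

end FddSpace

end

/-! The martingale property concerns uncountably many functions, times and events. The point is that
it is equivalent to countably many identities between finite dimensional laws, provided the process
is realized by a good version.

Topology and measurability. A Polish `E` sits in the Hilbert cube as a countable intersection of
open sets, so `𝒫(E)` sits in the same way in the compact metrizable space of laws on the cube and is
Polish. Continuous maps from a locally compact second countable space to a Polish space form a
Polish space, and the constraints of `ConsistentFamilies` are closed. The evaluations of `μ` are
kernels, so `solutionLaws` is cut out by countably many Borel conditions
(`measurableSet_solutionLaws`).

From solutions to identities (`IsSolution.mem_solutionLaws`). The martingale increment over `(s, t]`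
is tested against `∏ g_i(X_{r_i})`, and Fubini gives the defining identity.

From identities to solutions. Kolmogorov's theorem gives a process at rational times, and
`exists_progressive_process` extends it to real times by almost sure limits along grids, always read
from below. This version is jointly measurable, and up to time `s` it is a function of its own
values at rational times `≤ s`. Hence `*ℱ^X_s` lies in the σ-field of those values, which need not
hold for an arbitrary process with the same laws. The identities are then enlarged: from `𝒻` to `𝒟`
by A2 and dominated convergence with dominating function a multiple of `Φ`
(`evolution_eq_of_isBpGenerating`); from `𝒢` to indicators of closed sets by bp-density; to all
events of the rational σ-field by a π-λ argument; and from rational to real times by continuity in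
probability (`setIntegral_martingalePart_eq`). As `A f` is only Borel, adaptedness of its time
integral uses measurability of the occupation measure (`stronglyMeasurable_integral_process`). -/

noncomputable section

/-! ### Polish spaces as countable intersections of open sets -/

section Polish

/-- The diagonal map embeds `X` into the Polish product of the open sets `W i`. Its image is closed,
being described by the equality of all coordinates. -/
theorem polishSpace_of_isInducing_of_range_eq_iInter {X Y ι : Type*} [TopologicalSpace X]
    [TopologicalSpace Y] [PolishSpace Y] [Countable ι] [Nonempty ι] {f : X → Y}
    (hf : IsInducing f) (hinj : Function.Injective f) (W : ι → Set Y) (hW : ∀ i, IsOpen (W i))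
    (hrange : range f = ⋂ i, W i) : PolishSpace X := by
  have : ∀ i, PolishSpace (W i) := fun i => (hW i).polishSpace
  have hmem : ∀ x i, f x ∈ W i := fun x => mem_iInter.1 (hrange ▸ mem_range_self x)
  let g : X → ∀ i, W i := fun x i => ⟨f x, hmem x i⟩
  have hg : Continuous g :=
    continuous_pi fun i => hf.continuous.subtype_mk _
  let i₀ : ι := Classical.arbitrary ι
  have hfg : f = (fun z : ∀ i, W i => (z i₀ : Y)) ∘ g := rfl
  have hgi : IsInducing g := by
    refine IsInducing.of_comp hg ?_ (hfg ▸ hf)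
    fun_prop
  have hclosed : IsClosed (range g) := by
    have : range g = {z : ∀ i, W i | ∀ i, (z i : Y) = z i₀} := by
      ext z
      constructor
      · rintro ⟨x, rfl⟩ i
        rfl
      · intro hz
        have : (z i₀ : Y) ∈ range f := by
          rw [hrange, mem_iInter]
          exact fun i => hz i ▸ (z i).2
        obtain ⟨x, hx⟩ := this
        exact ⟨x, funext fun i => Subtype.ext (hx.trans (hz i).symm)⟩
    rw [this, ofPred_forall]
    exact isClosed_iInter fun i => isClosed_eq (by fun_prop) (by fun_prop)
  exact IsClosedEmbedding.polishSpace
    ⟨⟨hgi, fun x y h => hinj (congrArg (fun z : ∀ i, W i => (z i₀ : Y)) h)⟩, hclosed⟩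

/-- `V n` collects the points near which `e⁻¹` oscillates by at most `1 / (n + 1)`. At a point of
the closure of the range lying in every `V n`, the pulled back neighbourhood filter is Cauchy, and
its limit is a preimage by completeness. -/
theorem exists_isOpen_iInter_eq_range {E K : Type*} [MetricSpace E] [CompleteSpace E]
    [TopologicalSpace K] [TopologicalSpace.MetrizableSpace K] {e : E → K} (he : IsEmbedding e) :
    ∃ U : ℕ → Set K, (∀ n, IsOpen (U n)) ∧ range e = ⋂ n, U n := by
  let : MetricSpace K := TopologicalSpace.metrizableSpaceMetric K
  let V : ℕ → Set K := fun n => ⋃₀ {V | IsOpen V ∧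
    ∀ x y, e x ∈ V → e y ∈ V → dist x y ≤ 1 / (n + 1 : ℝ)}
  have hV : ∀ n, IsOpen (V n) := fun n => isOpen_sUnion fun V hV => hV.1
  have hVr : ∀ n, range e ⊆ V n := by
    rintro n _ ⟨x, rfl⟩
    have hpos : (0 : ℝ) < 1 / (n + 1) / 2 := by positivity
    obtain ⟨V, hVo, hV⟩ := he.isInducing.isOpen_iff.1 (Metric.isOpen_ball (x := x)
      (ε := 1 / (n + 1 : ℝ) / 2))
    refine ⟨V, ⟨hVo, fun y z hy hz => ?_⟩, ?_⟩
    · have hy' : y ∈ e ⁻¹' V := hy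
      have hz' : z ∈ e ⁻¹' V := hz
      rw [hV, Metric.mem_ball] at hy' hz'
      linarith [dist_triangle_right y z x]
    · change x ∈ e ⁻¹' V
      rw [hV]
      exact Metric.mem_ball_self hpos
  -- The thickenings intersect in the closure of the range.
  let T : ℕ → Set K := fun n => Metric.thickening (1 / (n + 1 : ℝ)) (range e)
  refine ⟨fun n => V n ∩ T n, fun n => (hV n).inter Metric.isOpen_thickening, ?_⟩
  refine Subset.antisymm (subset_iInter fun n => subset_inter (hVr n)
    (Metric.self_subset_thickening (by positivity) _)) fun y hy => ?_
  have hyV : ∀ n, y ∈ V n := fun n => (mem_iInter.1 hy n).1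
  have hyc : y ∈ closure (range e) := by
    rw [Metric.mem_closure_iff]
    intro ε hε
    obtain ⟨n, hn⟩ := exists_nat_one_div_lt hε
    obtain ⟨z, hz, hzy⟩ := Metric.mem_thickening_iff.1 (mem_iInter.1 hy n).2
    exact ⟨z, hz, hzy.trans hn⟩
  have hne : (comap e (𝓝 y)).NeBot := by
    rw [comap_neBot_iff]
    intro t ht
    obtain ⟨_, hz, x, rfl⟩ := mem_closure_iff_nhds.1 hyc t ht
    exact ⟨x, hz⟩
  have hcau : Cauchy (comap e (𝓝 y)) := by
    rw [Metric.cauchy_iff]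
    refine ⟨hne, fun ε hε => ?_⟩
    obtain ⟨n, hn⟩ := exists_nat_one_div_lt hε
    obtain ⟨V, ⟨hVo, hVd⟩, hyV⟩ := hyV n
    exact ⟨e ⁻¹' V, preimage_mem_comap (hVo.mem_nhds hyV),
      fun x hx z hz => (hVd x z hx hz).trans_lt hn⟩
  obtain ⟨x, hx⟩ := CompleteSpace.complete hcau
  have h1 : Tendsto e (comap e (𝓝 y)) (𝓝 (e x)) := (he.continuous.tendsto x).mono_left hx
  exact ⟨x, tendsto_nhds_unique h1 tendsto_comap⟩

end Polish

/-! ### Spaces of probability measures -/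

section ProbabilityMeasure

variable {E K : Type*} [TopologicalSpace E] [MeasurableSpace E] [BorelSpace E]
  [TopologicalSpace K] [MeasurableSpace K] [BorelSpace K]

/-- Every open set of `E` is the trace of an open set of `K`, so the portmanteau criterion on open
sets transfers from `K` to `E`. -/
theorem ProbabilityMeasure.isInducing_map [TopologicalSpace.MetrizableSpace K]
    [SecondCountableTopology K]
    {e : E → K} (he : IsEmbedding e) :
    IsInducing fun ν : ProbabilityMeasure E => ν.map he.continuous.measurable.aemeasurable := by
  rw [isInducing_iff_nhds]
  intro ν
  set F := fun ν : ProbabilityMeasure E => ν.map he.continuous.measurable.aemeasurable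
  have hF : Continuous F := ProbabilityMeasure.continuous_map he.continuous
  refine le_antisymm (hF.tendsto ν).le_comap ?_
  change Tendsto (fun x : ProbabilityMeasure E => x) (comap F (𝓝 (F ν))) (𝓝 ν)
  refine tendsto_of_forall_isOpen_le_liminf' fun G hG => ?_
  obtain ⟨V, hV, rfl⟩ := he.isInducing.isOpen_iff.1 hG
  have hmap : ∀ ρ : ProbabilityMeasure E, (ρ : Measure E) (e ⁻¹' V) = (F ρ : Measure K) V := by
    intro ρ
    rw [ProbabilityMeasure.toMeasure_map, Measure.map_apply he.continuous.measurable
      hV.measurableSet]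
  simp_rw [hmap]
  exact ProbabilityMeasure.le_liminf_measure_open_of_tendsto tendsto_comap hV

theorem ProbabilityMeasure.isOpen_setOf_lt_measure [HasOuterApproxClosed K] {U : Set K}
    (hU : IsOpen U) (c : ℝ≥0∞) : IsOpen {ν : ProbabilityMeasure K | c < (ν : Measure K) U} := by
  rw [isOpen_iff_mem_nhds]
  intro ν hν
  exact eventually_lt_of_lt_liminf (lt_of_lt_of_le hν
    (ProbabilityMeasure.le_liminf_measure_open_of_tendsto tendsto_id hU))

/-- Laws on `E` correspond to laws on the Hilbert cube giving full mass to each `U n`. Full mass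
means mass above `1 - 1 / (m + 1)` for every `m`, and each of these conditions is open by
portmanteau. -/
theorem ProbabilityMeasure.polishSpace [PolishSpace E] : PolishSpace (ProbabilityMeasure E) := by
  let := TopologicalSpace.upgradeIsCompletelyMetrizable E
  obtain ⟨e, he⟩ := Metric.PiNatEmbed.exists_embedding_to_hilbert_cube (X := E)
  obtain ⟨U, hU, hrange⟩ := exists_isOpen_iInter_eq_range he
  have : PolishSpace (ProbabilityMeasure (ℕ → unitInterval)) := by
    let := TopologicalSpace.metrizableSpaceMetric (ProbabilityMeasure (ℕ → unitInterval))
    infer_instance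
  have hem : MeasurableEmbedding e := he.continuous.measurableEmbedding he.injective
  refine polishSpace_of_isInducing_of_range_eq_iInter (ι := ℕ × ℕ)
    (ProbabilityMeasure.isInducing_map he) ?_
    (fun p => {ν | 1 - 1 / (p.2 + 1 : ℝ≥0∞) < (ν : Measure (ℕ → unitInterval)) (U p.1)})
    (fun p => ProbabilityMeasure.isOpen_setOf_lt_measure (hU p.1) _) ?_
  · intro ν ρ h
    refine Subtype.ext ?_
    have h' := congrArg (fun κ : ProbabilityMeasure (ℕ → unitInterval) =>
      (κ : Measure (ℕ → unitInterval)).comap e) h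
    simpa [hem.comap_map] using h'
  · ext ν
    simp only [mem_range, mem_iInter, mem_ofPred_eq, Prod.forall]
    constructor
    · rintro ⟨ρ, rfl⟩ n m
      rw [ProbabilityMeasure.toMeasure_map, Measure.map_apply hem.measurable (hU n).measurableSet]
      have : e ⁻¹' U n = univ := by
        rw [← univ_subset_iff, ← image_subset_iff, image_univ, hrange]
        exact iInter_subset _ n
      rw [this, measure_univ]
      exact ENNReal.sub_lt_self ENNReal.one_ne_top one_ne_zero (by simp)
    · intro h
      have hone : ∀ n, (ν : Measure (ℕ → unitInterval)) (U n) = 1 := by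
        intro n
        refine le_antisymm prob_le_one ?_
        have ht : Tendsto (fun m : ℕ => 1 - 1 / (m + 1 : ℝ≥0∞)) atTop (𝓝 (1 - 0)) := by
          refine ENNReal.Tendsto.sub tendsto_const_nhds ?_ (Or.inl ENNReal.one_ne_top)
          simpa [Function.comp_def] using
            ENNReal.tendsto_inv_nat_nhds_zero.comp (tendsto_add_atTop_nat 1)
        rw [tsub_zero] at ht
        exact le_of_tendsto' ht fun m => (h n m).le
      have hr : (ν : Measure (ℕ → unitInterval)) (range e)ᶜ = 0 := by
        rw [hrange, compl_iInter, measure_iUnion_null_iff]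
        intro n
        rw [measure_compl (hU n).measurableSet (measure_ne_top _ _), hone, measure_univ, tsub_self]
      have hc : ((ν : Measure (ℕ → unitInterval)).comap e).map e =
          (ν : Measure (ℕ → unitInterval)) := by
        rw [hem.map_comap, Measure.restrict_eq_self_of_ae_mem]
        exact hr
      have hp : IsProbabilityMeasure ((ν : Measure (ℕ → unitInterval)).comap e) := by
        constructor
        rw [← preimage_univ (f := e), ← Measure.map_apply hem.measurable MeasurableSet.univ, hc,
          measure_univ]
      exact ⟨⟨_, hp⟩, Subtype.ext hc⟩

end ProbabilityMeasure

theorem ContinuousMap.polishSpace {X Y : Type*} [TopologicalSpace X] [LocallyCompactSpace X]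
    [SecondCountableTopology X] [TopologicalSpace Y] [PolishSpace Y] : PolishSpace C(X, Y) := by
  let := TopologicalSpace.upgradeIsCompletelyMetrizable Y
  infer_instance

/-! ### The space of consistent families is Polish -/

section FddSpace

variable (E : Type*) [MetricSpace E] [SecondCountableTopology E]
  [MeasurableSpace E] [BorelSpace E]

theorem isClosed_symmetricLawMaps (n : ℕ) : IsClosed (SymmetricLawMaps E n) := by
  have : SymmetricLawMaps E n = ⋂ (π : Equiv.Perm (Fin n)) (f : (Fin n → E) →ᵇ ℝ)
      (t : Fin n → ℝ≥0), {μ : LawMaps E n |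
        ∫ x, f (fun i => x (π i)) ∂(μ t : Measure (Fin n → E)) =
          ∫ x, f x ∂(μ (fun i => t (π i)) : Measure (Fin n → E))} := by
    ext μ
    simp [SymmetricLawMaps]
  rw [this]
  refine isClosed_iInter fun π => isClosed_iInter fun f => isClosed_iInter fun t => ?_
  have hc : Continuous fun x : Fin n → E => fun i => x (π i) := by fun_prop
  have h1 := ProbabilityMeasure.continuous_integral_boundedContinuousFunction
    (f.compContinuous ⟨_, hc⟩)
  have h2 := ProbabilityMeasure.continuous_integral_boundedContinuousFunction f
  exact isClosed_eq (h1.comp (continuous_eval_const t)) (h2.comp (continuous_eval_const _))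

theorem isClosed_consistentFamilies : IsClosed (ConsistentFamilies E) := by
  refine IsClosed.inter (s₁ := {μ : LawFamilies E | _}) (s₂ := {μ : LawFamilies E | _}) ?_ ?_
  · simp only [ofPred_forall]
    refine isClosed_iInter fun m => isClosed_iInter fun t => ?_
    have hr : Continuous fun (x : Fin (m + 2) → E) (i : Fin (m + 1)) => x i.castSucc := by fun_prop
    have h1 : Continuous fun μ : LawFamilies E => (μ (m + 1)).1 t :=
      (continuous_eval_const t).comp (continuous_subtype_val.comp (continuous_apply (m + 1)))
    have h2 : Continuous fun μ : LawFamilies E => (μ m).1 fun i : Fin (m + 1) => t i.castSucc :=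
      (continuous_eval_const _).comp (continuous_subtype_val.comp (continuous_apply m))
    convert isClosed_eq ((ProbabilityMeasure.continuous_map hr).comp h1) h2 using 2 with μ
    ext μ
    exact (Subtype.ext_iff (a1 := ((μ (m + 1)).1 t).map hr.measurable.aemeasurable)
      (a2 := (μ m).1 fun i : Fin (m + 1) => t i.castSucc)).symm
  · simp only [ofPred_forall]
    refine isClosed_iInter fun t => ?_
    have h1 : Continuous fun μ : LawFamilies E => (μ 1).1 fun _ => t :=
      (continuous_eval_const _).comp (continuous_subtype_val.comp (continuous_apply 1))
    have hd : IsClosed {x : Fin 2 → E | x 0 = x 1} := isClosed_eq (by fun_prop) (by fun_prop)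
    -- Full mass on the closed diagonal means not charging its open complement, and charging an open
    -- set is an open condition.
    have h2 := (ProbabilityMeasure.isOpen_setOf_lt_measure hd.isOpen_compl 0).isClosed_compl
    convert h2.preimage h1 using 1
    ext μ
    simp [prob_compl_eq_zero_iff hd.measurableSet]

theorem polishSpace_consistentFamilies [CompleteSpace E] : PolishSpace (ConsistentFamilies E) := by
  have h1 : ∀ n, PolishSpace (ProbabilityMeasure (Fin n → E)) :=
    fun n => ProbabilityMeasure.polishSpace
  have h2 : ∀ n, PolishSpace (LawMaps E n) := fun n => ContinuousMap.polishSpace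
  have h3 : ∀ n, PolishSpace (SymmetricLawMaps E n) :=
    fun n => (isClosed_symmetricLawMaps E n).polishSpace
  exact (isClosed_consistentFamilies E).polishSpace

end FddSpace

/-! ### Bounded pointwise closure -/

section BpClosure

variable {α V : Type*} [NormedAddCommGroup V]

theorem subset_bpClosure (C : Set (α → V)) : C ⊆ bpClosure C :=
  subset_sInter fun _ hS => hS.1

theorem bpClosure_subset {C S : Set (α → V)} (hC : C ⊆ S)
    (hS : ∀ (u : ℕ → α → V) (v : α → V), (∀ n, u n ∈ S) → (∃ K : ℝ, ∀ n x, ‖u n x‖ ≤ K) →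
      (∀ x, Tendsto (fun n => u n x) atTop (𝓝 (v x))) → v ∈ S) : bpClosure C ⊆ S :=
  sInter_subset_of_mem ⟨hC, hS⟩

theorem mem_bpClosure_of_tendsto {C : Set (α → V)} {u : ℕ → α → V} {v : α → V}
    (hu : ∀ n, u n ∈ bpClosure C) {K : ℝ} (hK : ∀ n x, ‖u n x‖ ≤ K)
    (hv : ∀ x, Tendsto (fun n => u n x) atTop (𝓝 (v x))) : v ∈ bpClosure C :=
  mem_sInter.2 fun _ hS =>
    hS.2 u v (fun n => sInter_subset_of_mem hS (hu n)) ⟨K, hK⟩ hv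

/-- An induction principle for the bp-closure of a set of bounded measurable functions. -/
theorem bpClosure_induction [MeasurableSpace α] [MeasurableSpace V] [BorelSpace V]
    {C : Set (α → V)} {p : (α → V) → Prop}
    (hmeas : ∀ v ∈ C, Measurable v) (hbdd : ∀ v ∈ C, ∃ K : ℝ, ∀ x, ‖v x‖ ≤ K)
    (hC : ∀ v ∈ C, p v)
    (hlim : ∀ (u : ℕ → α → V) (v : α → V) (K : ℝ), (∀ n, Measurable (u n)) → Measurable v →
      (∀ n x, ‖u n x‖ ≤ K) → (∀ x, ‖v x‖ ≤ K) →
      (∀ x, Tendsto (fun n => u n x) atTop (𝓝 (v x))) → (∀ n, p (u n)) → p v)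
    {v : α → V} (hv : v ∈ bpClosure C) :
    Measurable v ∧ (∃ K : ℝ, ∀ x, ‖v x‖ ≤ K) ∧ p v := by
  refine bpClosure_subset (S := {v | Measurable v ∧ (∃ K : ℝ, ∀ x, ‖v x‖ ≤ K) ∧ p v})
    (fun v hv => ⟨hmeas v hv, hbdd v hv, hC v hv⟩) ?_ hv
  rintro u v hu ⟨K, hK⟩ hlim'
  have hvm : Measurable v := measurable_of_tendsto_metrizable (fun n => (hu n).1)
    (tendsto_pi_nhds.2 hlim')
  have hvK : ∀ x, ‖v x‖ ≤ K := fun x => le_of_tendsto' (hlim' x).norm fun n => hK n x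
  exact ⟨hvm, ⟨K, hvK⟩, hlim u v K (fun n => (hu n).1) hvm hK hvK hlim' fun n => (hu n).2.2⟩

end BpClosure

/-! ### A countable bp-dense set -/

section BpDense

theorem BoundedContinuousFunction.foldr_sup_le {E : Type*} [TopologicalSpace E]
    {L : List (E →ᵇ ℝ)} {x : E} {c : ℝ} (hc : 0 ≤ c) (hL : ∀ f ∈ L, f x ≤ c) :
    (L.foldr (· ⊔ ·) 0) x ≤ c := by
  induction L with
  | nil => simpa
  | cons f L ih =>
    simp only [List.foldr_cons, BoundedContinuousFunction.coe_sup, Pi.sup_apply]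
    exact sup_le (hL f (by simp)) (ih fun g hg => hL g (by simp [hg]))

theorem BoundedContinuousFunction.foldr_sup_nonneg {E : Type*} [TopologicalSpace E]
    (L : List (E →ᵇ ℝ)) (x : E) : 0 ≤ (L.foldr (· ⊔ ·) 0) x := by
  induction L with
  | nil => simp
  | cons f L ih =>
    simp only [List.foldr_cons, BoundedContinuousFunction.coe_sup, Pi.sup_apply]
    exact le_sup_of_le_right ih

theorem BoundedContinuousFunction.le_foldr_sup {E : Type*} [TopologicalSpace E]
    {L : List (E →ᵇ ℝ)} {f : E →ᵇ ℝ} (hf : f ∈ L) (x : E) : f x ≤ (L.foldr (· ⊔ ·) 0) x := by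
  induction L with
  | nil => simp at hf
  | cons g L ih =>
    simp only [List.foldr_cons, BoundedContinuousFunction.coe_sup, Pi.sup_apply]
    rcases List.mem_cons.1 hf with rfl | hf
    · exact le_sup_left
    · exact le_sup_of_le_right (ih hf)

variable {E : Type*} [MetricSpace E]

/-- A continuous function of height `r`, equal to `r` on the ball of radius `1 / n` around `z` and
vanishing outside the ball of radius `2 / n`. -/
def plateau (z : E) (n : ℕ) (r : ℚ≥0) : E →ᵇ ℝ :=
  BoundedContinuousFunction.ofNormedAddCommGroup
    (fun x => (r : ℝ) * min 1 (max 0 (2 - n * dist x z))) (by fun_prop) r (fun x => by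
      have h0 : 0 ≤ min 1 (max 0 (2 - n * dist x z)) := le_min zero_le_one (le_max_left _ _)
      rw [Real.norm_eq_abs, abs_of_nonneg (by positivity)]
      exact mul_le_of_le_one_right (by positivity) (min_le_left _ _))

theorem plateau_apply (z : E) (n : ℕ) (r : ℚ≥0) (x : E) :
    plateau z n r x = (r : ℝ) * min 1 (max 0 (2 - n * dist x z)) := rfl

/-- The height is a rational between `c` and `H x`, and the centre is a point of the dense sequence
so close to `x` that the support stays where `H` exceeds this height. -/
theorem exists_plateau_le {H : E → ℝ} (hH : Continuous H) (h0 : ∀ x, 0 ≤ H x) {d : ℕ → E}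
    (hd : DenseRange d) {x : E} {c : ℝ} (hc : c < H x) :
    ∃ (i n : ℕ) (r : ℚ≥0), (∀ y, plateau (d i) n r y ≤ H y) ∧ c ≤ plateau (d i) n r x := by
  rcases lt_or_ge c 0 with hneg | hpos
  · exact ⟨0, 0, 0, fun y => by simpa [plateau_apply] using h0 y, by simpa [plateau_apply] using hneg.le⟩
  obtain ⟨q, hcq, hqH⟩ := exists_rat_btwn hc
  have hq : 0 ≤ q := by exact_mod_cast hpos.trans hcq.le
  lift q to ℚ≥0 using hq
  obtain ⟨δ, hδ, hball⟩ := Metric.isOpen_iff.1 (isOpen_lt continuous_const hH) x hqH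
  -- The support has radius `2 / (m + 1)` about a centre within `1 / (m + 1)` of `x`, whence the
  -- factor 3.
  obtain ⟨m, hm⟩ := exists_nat_one_div_lt (show 0 < δ / 3 by positivity)
  have hm0 : (0 : ℝ) < 1 / (m + 1) := by positivity
  obtain ⟨i, hi⟩ := hd.exists_dist_lt x hm0
  have hcast : (((m + 1 : ℕ) : ℝ)) = (m : ℝ) + 1 := by push_cast; ring
  have hm1 : (0 : ℝ) < (m : ℝ) + 1 := by positivity
  refine ⟨i, m + 1, q, fun y => ?_, ?_⟩
  · rw [plateau_apply, hcast]
    by_cases hy : dist y (d i) < 2 / (m + 1)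
    · have hyx : dist y x < δ := by
        have h1 := dist_triangle_right y x (d i)
        have h2 : (2 : ℝ) / (m + 1) = 2 * (1 / (m + 1)) := by ring
        linarith
      have h3 : ((q : ℚ) : ℝ) < H y := hball hyx
      refine le_trans (mul_le_of_le_one_right (by positivity) (min_le_left _ _)) ?_
      exact_mod_cast h3.le
    · have h4 : 2 - ((m : ℝ) + 1) * dist y (d i) ≤ 0 := by
        rw [not_lt, div_le_iff₀ hm1] at hy
        linarith
      rw [max_eq_left h4, min_eq_right zero_le_one, mul_zero]
      exact h0 y
  · rw [plateau_apply, hcast]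
    have h5 : ((m : ℝ) + 1) * dist x (d i) ≤ 1 := by
      rw [lt_div_iff₀ hm1] at hi
      linarith
    rw [min_eq_left (le_max_of_le_right (by linarith)), mul_one]
    exact_mod_cast hcq.le

/-- After adding a constant `N ≥ ‖h‖`, the function is nonnegative, hence the supremum of the
countably many rational plateaus below it. Finite maxima of these, minus `N`, increase to `h` and
stay between `-N` and `N`. -/
theorem exists_countable_isBpDense (E : Type*) [MetricSpace E] [SecondCountableTopology E] :
    ∃ 𝒢 : Set (E →ᵇ ℝ), 𝒢.Countable ∧ IsBpDense 𝒢 := by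
  rcases isEmpty_or_nonempty E with hE | hE
  · refine ⟨{0}, countable_singleton 0, fun h => subset_bpClosure _ ⟨0, rfl, Subsingleton.elim _ _⟩⟩
  let d := TopologicalSpace.denseSeq E
  let b : ℕ × ℕ × ℚ≥0 → E →ᵇ ℝ := fun p => plateau (d p.1) p.2.1 p.2.2
  let G : List (ℕ × ℕ × ℚ≥0) × ℕ → E →ᵇ ℝ := fun p =>
    (p.1.map b).foldr (· ⊔ ·) 0 - BoundedContinuousFunction.const E (p.2 : ℝ)
  refine ⟨range G, countable_range G, fun h => ?_⟩
  obtain ⟨N, hN⟩ := exists_nat_ge ‖h‖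
  have hhN : ∀ x, |h x| ≤ N := fun x => (h.norm_coe_le_norm x).trans hN
  have hH0 : ∀ x, 0 ≤ h x + N := fun x => by linarith [neg_le_of_abs_le (hhN x)]
  let I : Set (ℕ × ℕ × ℚ≥0) := {p | ∀ y, b p y ≤ h y + N}
  have hI0 : I.Nonempty := ⟨(0, 0, 0), fun y => by simpa [b, plateau_apply] using hH0 y⟩
  obtain ⟨φ, hφ⟩ := (to_countable I).exists_eq_range hI0
  let u : ℕ → E →ᵇ ℝ := fun n => G ((List.range n).map φ, N)
  have hu_le : ∀ n x, u n x ≤ h x := by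
    intro n x
    have : (((List.range n).map φ).map b).foldr (· ⊔ ·) 0 x ≤ h x + N := by
      refine BoundedContinuousFunction.foldr_sup_le (hH0 x) fun f hf => ?_
      simp only [List.map_map, List.mem_map, List.mem_range, Function.comp_apply] at hf
      obtain ⟨k, -, rfl⟩ := hf
      have : φ k ∈ I := hφ ▸ mem_range_self k
      exact this x
    simp only [u, G, BoundedContinuousFunction.coe_sub, Pi.sub_apply,
      BoundedContinuousFunction.const_apply]
    linarith
  have hu_ge : ∀ n x, -(N : ℝ) ≤ u n x := by
    intro n x
    have := BoundedContinuousFunction.foldr_sup_nonneg (((List.range n).map φ).map b) x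
    simp only [u, G, BoundedContinuousFunction.coe_sub, Pi.sub_apply,
      BoundedContinuousFunction.const_apply]
    linarith
  refine mem_bpClosure_of_tendsto (u := fun n => u n) (K := N)
    (fun n => subset_bpClosure _ ⟨u n, mem_range_self _, rfl⟩) (fun n x => ?_) fun x => ?_
  · rw [Real.norm_eq_abs, abs_le]
    exact ⟨hu_ge n x, (hu_le n x).trans (le_of_abs_le (hhN x))⟩
  · refine tendsto_order.2 ⟨fun c hc => ?_, fun c hc =>
      Eventually.of_forall fun n => (hu_le n x).trans_lt hc⟩
    obtain ⟨c', hcc', hc'⟩ := exists_between hc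
    obtain ⟨i, n, r, hle, hx⟩ := exists_plateau_le (H := fun x => h x + N) (by fun_prop) hH0
      (TopologicalSpace.denseRange_denseSeq E) (x := x) (c := c' + N) (by linarith)
    have hmem : (i, n, r) ∈ range φ := hφ ▸ hle
    obtain ⟨k, hk⟩ := hmem
    filter_upwards [eventually_gt_atTop k] with m hm
    have hmem : b (φ k) ∈ ((List.range m).map φ).map b := by
      simp only [List.map_map, List.mem_map, List.mem_range, Function.comp_apply]
      exact ⟨k, hm, rfl⟩
    have := BoundedContinuousFunction.le_foldr_sup hmem x
    rw [hk] at this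
    simp only [u, G, BoundedContinuousFunction.coe_sub, Pi.sub_apply,
      BoundedContinuousFunction.const_apply]
    have h2 : c' + N ≤ b (i, n, r) x := hx
    linarith

theorem IsBpDense.indicator_mem_bpClosure {𝒢 : Set (E →ᵇ ℝ)} (h𝒢 : IsBpDense 𝒢) {F : Set E}
    (hF : IsClosed F) :
    F.indicator (fun _ => (1 : ℝ)) ∈ bpClosure ((fun g : E →ᵇ ℝ => (g : E → ℝ)) '' 𝒢) := by
  have hpos : ∀ n : ℕ, (0 : ℝ) < 1 / (n + 1) := fun n => by positivity
  let g : ℕ → E →ᵇ ℝ := fun n => BoundedContinuousFunction.comp NNReal.toReal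
    (LipschitzWith.subtype_val _) (thickenedIndicator (hpos n) F)
  have hg : ∀ n x, g n x = (thickenedIndicator (hpos n) F x : ℝ) := fun _ _ => rfl
  refine mem_bpClosure_of_tendsto (u := fun n => g n) (K := 1) (fun n => h𝒢 (g n)) ?_ ?_
  · intro n x
    rw [hg, Real.norm_eq_abs, abs_of_nonneg (NNReal.coe_nonneg _)]
    exact_mod_cast thickenedIndicator_le_one (hpos n) F x
  · intro x
    have h1 := thickenedIndicator_tendsto_indicator_closure hpos
      tendsto_one_div_add_atTop_nhds_zero_nat F
    rw [tendsto_pi_nhds] at h1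
    have h2 := (NNReal.continuous_coe.tendsto _).comp (h1 x)
    rw [hF.closure_eq] at h2
    have h3 : F.indicator (fun _ => (1 : ℝ)) x = ((F.indicator (fun _ => (1 : ℝ≥0)) x : ℝ≥0) : ℝ) := by
      by_cases hx : x ∈ F <;> simp [hx]
    rw [h3]
    exact h2

end BpDense

/-! ### Measurability of the set of solution laws -/

section BorelLaws

variable {E K : Type*}

/-- The Borel σ-field of the weak topology makes all evaluations at measurable sets measurable. -/
theorem ProbabilityMeasure.measurable_toMeasure_of_continuous [TopologicalSpace K]
    [MeasurableSpace K] [BorelSpace K] [HasOuterApproxClosed K]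
    {Z : Type*} [TopologicalSpace Z] [MeasurableSpace Z] [BorelSpace Z]
    {F : Z → ProbabilityMeasure K} (hF : Continuous F) :
    Measurable fun z => (F z : Measure K) := by
  refine Measure.measurable_of_measurable_coe _ fun B hB => ?_
  induction B, hB using MeasurableSpace.induction_on_inter (s := {U : Set K | IsOpen U})
    (BorelSpace.measurable_eq) isPiSystem_isOpen with
  | empty => simp
  | basic U hU =>
    refine measurable_of_Ioi fun c => ?_
    exact ((ProbabilityMeasure.isOpen_setOf_lt_measure hU c).preimage hF).measurableSet
  | compl B hB ih =>
    simp_rw [prob_compl_eq_one_sub hB]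
    exact ih.const_sub 1
  | iUnion f hd hf ih =>
    simp_rw [measure_iUnion hd hf]
    exact Measurable.tsum ih

variable [MetricSpace E] [SecondCountableTopology E] [MeasurableSpace E] [BorelSpace E]

omit [SecondCountableTopology E] in
theorem measurable_tensorFun {k : ℕ} (g : Fin k → E →ᵇ ℝ) {h : E → ℝ} (hh : Measurable h) :
    Measurable (tensorFun g h) := by
  unfold tensorFun
  refine Measurable.mul ?_ (hh.comp (measurable_pi_apply _))
  exact Finset.measurable_prod _ fun i _ =>
    (g i).continuous.measurable.comp (measurable_pi_apply _)

theorem continuous_times {k : ℕ} (r : Fin k → ℚ≥0) : Continuous (times r) := by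
  refine continuous_pi fun i => ?_
  refine Fin.lastCases ?_ (fun j => ?_) i
  · simp [times, continuous_id']
  · simpa [times] using continuous_const

/-- Evaluation is jointly continuous in the map and the time, because the time space is locally
compact. -/
theorem measurable_lawAt [CompleteSpace E] [MeasurableSpace (ConsistentFamilies E)]
    [BorelSpace (ConsistentFamilies E)] (m : ℕ) {T : ℝ≥0 → Fin (m + 1) → ℝ≥0}
    (hT : Continuous T) :
    Measurable fun p : ConsistentFamilies E × ℝ => lawAt p.1 m (T p.2.toNNReal) := by
  have := polishSpace_consistentFamilies E
  refine ProbabilityMeasure.measurable_toMeasure_of_continuous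
    (F := fun p : ConsistentFamilies E × ℝ => (p.1.1 m).1 (T p.2.toNNReal)) ?_
  have h1 : Continuous fun p : ConsistentFamilies E × ℝ => (p.1.1 m).1 :=
    continuous_subtype_val.comp ((continuous_apply m).comp
      (continuous_subtype_val.comp continuous_fst))
  have h2 : Continuous fun p : ConsistentFamilies E × ℝ => T p.2.toNNReal :=
    hT.comp (continuous_real_toNNReal.comp continuous_snd)
  exact h1.eval h2

/-- The laws `μ^{m+1}(T u)` as a kernel in `(μ, u)`. -/
def lawKernel [CompleteSpace E] [MeasurableSpace (ConsistentFamilies E)]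
    [BorelSpace (ConsistentFamilies E)] (m : ℕ) {T : ℝ≥0 → Fin (m + 1) → ℝ≥0}
    (hT : Continuous T) :
    ProbabilityTheory.Kernel (ConsistentFamilies E × ℝ) (Fin (m + 1) → E) where
  toFun p := lawAt p.1 m (T p.2.toNNReal)
  measurable' := measurable_lawAt m hT

instance (μ : ConsistentFamilies E) (m : ℕ) (t : Fin (m + 1) → ℝ≥0) :
    IsProbabilityMeasure (lawAt μ m t) := by
  unfold lawAt
  infer_instance

instance [CompleteSpace E] [MeasurableSpace (ConsistentFamilies E)]
    [BorelSpace (ConsistentFamilies E)] (m : ℕ) {T : ℝ≥0 → Fin (m + 1) → ℝ≥0}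
    (hT : Continuous T) : ProbabilityTheory.IsMarkovKernel (lawKernel (E := E) m hT) :=
  ⟨fun p => inferInstanceAs (IsProbabilityMeasure (lawAt p.1 m (T p.2.toNNReal)))⟩

theorem measurable_integral_lawAt [CompleteSpace E] [MeasurableSpace (ConsistentFamilies E)]
    [BorelSpace (ConsistentFamilies E)] (m : ℕ) {T : ℝ≥0 → Fin (m + 1) → ℝ≥0}
    (hT : Continuous T) {h : (Fin (m + 1) → E) → ℝ} (hh : Measurable h) :
    StronglyMeasurable fun p : ConsistentFamilies E × ℝ =>
      ∫ x, h x ∂(lawAt p.1 m (T p.2.toNNReal)) :=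
  hh.stronglyMeasurable.integral_kernel (κ := lawKernel m hT)

/-- Only countably many `k`, `g`, `f` and rational times occur, and each condition compares
integrals against kernels, which are measurable in `μ`. -/
theorem measurableSet_solutionLaws [CompleteSpace E] {𝒟 : Set (E →ᵇ ℝ)} {A : 𝒟 → E → ℝ}
    (hA : ∀ f, Measurable (A f)) {Φ : E → ℝ≥0} (hΦ : Measurable Φ) {𝒻 : Set 𝒟}
    (h𝒻 : 𝒻.Countable) {𝒢 : Set (E →ᵇ ℝ)} (h𝒢 : 𝒢.Countable) :
    MeasurableSet[borel (ConsistentFamilies E)] (solutionLaws A Φ 𝒻 𝒢) := by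
  let _ : MeasurableSpace (ConsistentFamilies E) := borel _
  have _ : BorelSpace (ConsistentFamilies E) := ⟨rfl⟩
  have : solutionLaws A Φ 𝒻 𝒢 =
      (⋂ N : ℕ, {μ : ConsistentFamilies E | ∫⁻ s in Ioc (0 : ℝ) N,
        ∫⁻ x, (Φ (x 0) : ℝ≥0∞) ∂(lawAt μ 0 (fun _ => s.toNNReal)) < ∞}) ∩
      ⋂ (k : ℕ) (_ : 1 ≤ k), ⋂ g ∈ {g : Fin k → E →ᵇ ℝ | ∀ i, g i ∈ 𝒢}, ⋂ f ∈ 𝒻,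
        ⋂ (r : Fin k → ℚ≥0) (s : ℚ≥0) (t : ℚ≥0) (_ : ∀ i, r i ≤ s) (_ : s ≤ t),
        {μ : ConsistentFamilies E |
          (∫ x, tensorFun g (f : E →ᵇ ℝ) x ∂(lawAt μ k (times r (t : ℝ≥0)))) -
            (∫ x, tensorFun g (f : E →ᵇ ℝ) x ∂(lawAt μ k (times r (s : ℝ≥0)))) =
          ∫ u in (s : ℝ)..(t : ℝ),
            ∫ x, tensorFun g (A f) x ∂(lawAt μ k (times r u.toNNReal))} := by
    ext μ
    simp only [solutionLaws, mem_inter_iff, mem_iInter, mem_ofPred_eq]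
  rw [this]
  refine MeasurableSet.inter (MeasurableSet.iInter fun N => ?_) ?_
  · refine measurableSet_lt (Measurable.lintegral_prod_right' (ν := volume.restrict (Ioc 0 (N : ℝ)))
      (f := fun p : ConsistentFamilies E × ℝ =>
        ∫⁻ x, (Φ (x 0) : ℝ≥0∞) ∂(lawAt p.1 0 (fun _ => p.2.toNNReal))) ?_) measurable_const
    have h0 : Measurable fun x : Fin (0 + 1) → E => (Φ (x 0) : ℝ≥0∞) := by fun_prop
    exact h0.lintegral_kernel (κ := lawKernel 0 (T := fun u _ => u) (by fun_prop))
  · refine MeasurableSet.iInter fun k => MeasurableSet.iInter fun _ =>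
      MeasurableSet.biInter (Set.countable_pi fun _ => h𝒢) fun g _ =>
      MeasurableSet.biInter h𝒻 fun f _ =>
      MeasurableSet.iInter fun r => MeasurableSet.iInter fun s => MeasurableSet.iInter fun t =>
      MeasurableSet.iInter fun _ => MeasurableSet.iInter fun _ => ?_
    have h1 : Measurable (tensorFun g (f : E →ᵇ ℝ)) :=
      measurable_tensorFun g (f : E →ᵇ ℝ).continuous.measurable
    have h2 := measurable_integral_lawAt k (continuous_times r) (measurable_tensorFun g (hA f))
    have h3 : ∀ t : ℝ≥0, Measurable fun μ : ConsistentFamilies E =>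
        ∫ x, tensorFun g (f : E →ᵇ ℝ) x ∂(lawAt μ k (times r t)) := fun t => by
      simpa [Function.comp_def] using (measurable_integral_lawAt k (continuous_times r) h1).measurable.comp
        (measurable_prodMk_right (y := (t : ℝ)))
    refine measurableSet_eq_fun ((h3 _).sub (h3 _)) ?_
    simp_rw [intervalIntegral]
    exact (h2.integral_prod_right' (ν := volume.restrict (Ioc (s : ℝ) t))).measurable.sub
      (h2.integral_prod_right' (ν := volume.restrict (Ioc (t : ℝ) s))).measurable

theorem standardBorelSpace_of_measurableSet_borel {Z : Type*} [TopologicalSpace Z] [PolishSpace Z]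
    {s : Set Z} (hs : MeasurableSet[borel Z] s) : @StandardBorelSpace s (borel s) := by
  borelize Z
  have h := hs.standardBorel
  rwa [Subtype.borelSpace s |>.measurable_eq] at h

end BorelLaws

/-! ### Convergence in probability -/

section ConvergenceInProbability

variable {Ω : Type*} {mΩ : MeasurableSpace Ω} {P : Measure Ω}

theorem TendstoInMeasure.pi {ι κ : Type*} [Fintype κ] {E : κ → Type*} [∀ k, EDist (E k)]
    {l : Filter ι} {f : ι → Ω → ∀ k, E k} {g : Ω → ∀ k, E k}
    (h : ∀ k, TendstoInMeasure P (fun i ω => f i ω k) l (fun ω => g ω k)) :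
    TendstoInMeasure P f l g := by
  intro ε hε
  have hs : Tendsto (fun i => ∑ k, P {ω | ε ≤ edist (f i ω k) (g ω k)}) l (𝓝 0) := by
    simpa using tendsto_finsetSum (f := fun k i => P {ω | ε ≤ edist (f i ω k) (g ω k)})
      (a := fun _ => 0) Finset.univ fun k _ => h k ε hε
  refine tendsto_of_tendsto_of_tendsto_of_le_of_le tendsto_const_nhds hs (fun _ => zero_le)
    fun i => ?_
  refine (measure_mono fun ω hω => ?_).trans (measure_iUnion_fintype_le P _)
  by_contra hc
  simp only [mem_iUnion, mem_ofPred_eq, not_exists, not_le] at hc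
  rw [mem_ofPred_eq, edist_pi_def] at hω
  exact absurd hω (not_le.2 ((Finset.sup_lt_iff (bot_lt_iff_ne_bot.2 hε.ne')).2 fun k _ => hc k))

/-- Every subsequence has a further subsequence converging almost everywhere, to which dominated
convergence applies. -/
theorem tendsto_integral_of_tendstoInMeasure [IsFiniteMeasure P] {F : Type*}
    [PseudoEMetricSpace F] [MeasurableSpace F] [OpensMeasurableSpace F]
    {Y : ℕ → Ω → F} {Z : Ω → F} (hY : ∀ n, Measurable (Y n))
    (h : TendstoInMeasure P Y atTop Z) (f : F →ᵇ ℝ) :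
    Tendsto (fun n => ∫ ω, f (Y n ω) ∂P) atTop (𝓝 (∫ ω, f (Z ω) ∂P)) := by
  refine tendsto_of_subseq_tendsto fun ns hns => ?_
  obtain ⟨ms, -, hms⟩ := (h.comp hns).exists_seq_tendsto_ae
  refine ⟨ms, tendsto_integral_of_dominated_convergence (fun _ => ‖f‖)
    (fun n => (f.continuous.measurable.comp (hY _)).aestronglyMeasurable) (integrable_const _)
    (fun n => Eventually.of_forall fun ω => f.norm_coe_le_norm _) ?_⟩
  filter_upwards [hms] with ω hω
  exact (f.continuous.tendsto _).comp hω

end ConvergenceInProbability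

/-! ### Finite dimensional laws of a process -/

section FiniteDimensionalLaws

variable {E : Type*} [MetricSpace E] [SecondCountableTopology E] [MeasurableSpace E] [BorelSpace E]
variable {Ω : Type*} {mΩ : MeasurableSpace Ω} {P : Measure Ω} {X : ℝ≥0 → Ω → E}

theorem exists_hasFiniteDimLaws [IsProbabilityMeasure P] (hX : ∀ t, Measurable (X t))
    (hc : IsContinuousInProbability P X) : ∃ μ : ConsistentFamilies E, HasFiniteDimLaws P X μ := by
  have hm : ∀ (n : ℕ) (t : Fin n → ℝ≥0), Measurable fun ω i => X (t i) ω :=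
    fun n t => measurable_pi_lambda _ fun i => hX _
  let L : ∀ n, (Fin n → ℝ≥0) → ProbabilityMeasure (Fin n → E) := fun n t =>
    ⟨P.map fun ω i => X (t i) ω, Measure.isProbabilityMeasure_map (hm n t).aemeasurable⟩
  have hint : ∀ (n : ℕ) (t : Fin n → ℝ≥0) (f : (Fin n → E) →ᵇ ℝ),
      ∫ x, f x ∂(L n t : Measure (Fin n → E)) = ∫ ω, f (fun i => X (t i) ω) ∂P := fun n t f =>
    integral_map (hm n t).aemeasurable f.continuous.measurable.aestronglyMeasurable
  have hL : ∀ n, Continuous (L n) := by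
    intro n
    rw [ProbabilityMeasure.continuous_iff_forall_continuous_integral]
    intro f
    simp_rw [hint]
    refine SeqContinuous.continuous fun u t hu => ?_
    refine tendsto_integral_of_tendstoInMeasure (fun k => hm n (u k)) (TendstoInMeasure.pi
      fun i => ?_) f
    exact (hc (t i)).comp (tendsto_pi_nhds.1 hu i)
  refine ⟨⟨fun m => ⟨⟨L (m + 1), hL _⟩, fun π f t => ?_⟩, fun m t => ?_, fun t => ?_⟩,
    fun m t => rfl⟩
  · have hπ : Continuous fun x : Fin (m + 1) → E => fun i => x (π i) := by fun_prop
    exact (hint (m + 1) t (f.compContinuous ⟨_, hπ⟩)).trans (hint (m + 1) (fun i => t (π i)) f).symm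
  · change Measure.map _ (P.map fun ω i => X (t i) ω) = P.map fun ω (i : Fin (m + 1)) => X (t i.castSucc) ω
    rw [Measure.map_map (by fun_prop) (hm _ t)]
    rfl
  · change (P.map fun ω (_ : Fin 2) => X t ω) {x | x 0 = x 1} = 1
    have hd : IsClosed {x : Fin 2 → E | x 0 = x 1} := isClosed_eq (by fun_prop) (by fun_prop)
    rw [Measure.map_apply (hm 2 fun _ => t) hd.measurableSet]
    simp

theorem HasFiniteDimLaws.integral_tensorFun {μ : ConsistentFamilies E}
    (h : HasFiniteDimLaws P X μ) (hX : ∀ t, Measurable (X t)) {k : ℕ} (g : Fin k → E →ᵇ ℝ)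
    {f : E → ℝ} (hf : Measurable f) (r : Fin k → ℚ≥0) (u : ℝ≥0) :
    ∫ x, tensorFun g f x ∂(lawAt μ k (times r u)) =
      ∫ ω, (∏ i, g i (X (r i) ω)) * f (X u ω) ∂P := by
  rw [← h k (times r u), integral_map (measurable_pi_lambda _ fun i => hX _).aemeasurable
    (measurable_tensorFun g hf).aestronglyMeasurable]
  simp [tensorFun, times]

end FiniteDimensionalLaws

/-! ### Integrability and Fubini for time integrals -/

section OccupationIntegrals

variable {E : Type*} [MeasurableSpace E]
variable {Ω : Type*} {mΩ : MeasurableSpace Ω} {P : Measure Ω} {X : ℝ≥0 → Ω → E}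
  {Φ : E → ℝ≥0} {h : E → ℝ} {C : ℝ}

/-- The time integrals `∫_0^T Φ(X_s) ds` have finite expectation. -/
def HasFiniteOccupation (P : Measure Ω) (X : ℝ≥0 → Ω → E) (Φ : E → ℝ≥0) : Prop :=
  ∀ T : ℝ≥0, ∫⁻ ω, (∫⁻ s in Ioc (0 : ℝ) T, (Φ (X s.toNNReal ω) : ℝ≥0∞)) ∂P < ∞

theorem measurable_process_prod (hX : Measurable (Function.uncurry X)) :
    Measurable fun p : Ω × ℝ => X p.2.toNNReal p.1 :=
  hX.comp ((measurable_real_toNNReal.comp measurable_snd).prodMk measurable_fst)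

theorem measurable_process_apply (hX : Measurable (Function.uncurry X)) (t : ℝ≥0) :
    Measurable (X t) :=
  hX.comp measurable_prodMk_left

theorem integrable_process_prod (hX : Measurable (Function.uncurry X)) (hΦ : Measurable Φ)
    (hΦX : HasFiniteOccupation P X Φ) (hh : Measurable h) (hC : ∀ x, |h x| ≤ C * Φ x) (T : ℝ≥0) :
    Integrable (fun p : Ω × ℝ => h (X p.2.toNNReal p.1))
      (P.prod (volume.restrict (Ioc (0 : ℝ) T))) := by
  have hm := measurable_process_prod hX
  have hI : Integrable (fun p : Ω × ℝ => (Φ (X p.2.toNNReal p.1) : ℝ))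
      (P.prod (volume.restrict (Ioc (0 : ℝ) T))) := by
    refine ⟨(hΦ.comp hm).coe_nnreal_real.aestronglyMeasurable, ?_⟩
    rw [hasFiniteIntegral_iff_enorm]
    simp only [Real.enorm_of_nonneg (NNReal.coe_nonneg _)]
    rw [lintegral_prod _ (by fun_prop)]
    simpa using hΦX T
  refine (hI.const_mul C).mono (hh.comp hm).aestronglyMeasurable (Eventually.of_forall fun p => ?_)
  exact (hC _).trans (le_abs_self _)

variable [IsFiniteMeasure P]

theorem ae_intervalIntegrable_process (hX : Measurable (Function.uncurry X)) (hΦ : Measurable Φ)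
    (hΦX : HasFiniteOccupation P X Φ) (hh : Measurable h) (hC : ∀ x, |h x| ≤ C * Φ x)
    (s t : ℝ≥0) :
    ∀ᵐ ω ∂P, IntervalIntegrable (fun u => h (X u.toNNReal ω)) volume s t := by
  have h1 := (integrable_process_prod hX hΦ hΦX hh hC (max s t)).prod_right_ae
  filter_upwards [h1] with ω hω
  rw [intervalIntegrable_iff]
  refine IntegrableOn.mono_set (t := Ioc (0 : ℝ) (max s t : ℝ≥0)) hω (fun x hx => ?_)
  rw [mem_uIoc] at hx
  rcases hx with hx | hx
  · exact ⟨s.coe_nonneg.trans_lt hx.1, hx.2.trans (by exact_mod_cast le_max_right s t)⟩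
  · exact ⟨t.coe_nonneg.trans_lt hx.1, hx.2.trans (by exact_mod_cast le_max_left s t)⟩

omit [IsFiniteMeasure P] in
theorem integrable_mul_process_prod (hX : Measurable (Function.uncurry X)) (hΦ : Measurable Φ)
    (hΦX : HasFiniteOccupation P X Φ) (hh : Measurable h) (hC : ∀ x, |h x| ≤ C * Φ x)
    {ξ : Ω → ℝ} (hξ : Measurable ξ) {c : ℝ} (hc : ∀ ω, ‖ξ ω‖ ≤ c) (s t : ℝ≥0) :
    Integrable (fun p : Ω × ℝ => ξ p.1 * h (X p.2.toNNReal p.1))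
      (P.prod (volume.restrict (Ioc (s : ℝ) t))) := by
  have h1 := integrable_process_prod hX hΦ hΦX hh hC t
  have h2 : Integrable (fun p : Ω × ℝ => h (X p.2.toNNReal p.1))
      (P.prod (volume.restrict (Ioc (s : ℝ) t))) :=
    h1.mono_measure (Measure.prod_mono le_rfl
      (Measure.restrict_mono (Ioc_subset_Ioc_left s.coe_nonneg) le_rfl))
  exact h2.bdd_mul (hξ.comp measurable_fst).aestronglyMeasurable
    (Eventually.of_forall fun p => hc p.1)

omit [IsFiniteMeasure P] in
theorem integrable_mul_integral_process (hX : Measurable (Function.uncurry X)) (hΦ : Measurable Φ)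
    (hΦX : HasFiniteOccupation P X Φ) (hh : Measurable h) (hC : ∀ x, |h x| ≤ C * Φ x)
    {ξ : Ω → ℝ} (hξ : Measurable ξ) {c : ℝ} (hc : ∀ ω, ‖ξ ω‖ ≤ c) {s t : ℝ≥0} (hst : s ≤ t) :
    Integrable (fun ω => ξ ω * ∫ u in (s : ℝ)..t, h (X u.toNNReal ω)) P := by
  have h1 := (integrable_mul_process_prod hX hΦ hΦX hh hC hξ hc s t).integral_prod_left
  refine h1.congr (Eventually.of_forall fun ω => ?_)
  change ∫ u in Ioc (s : ℝ) t, ξ ω * h (X u.toNNReal ω) = _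
  simp only [intervalIntegral.integral_of_le (NNReal.coe_le_coe.2 hst), integral_const_mul]

omit [IsFiniteMeasure P] in
theorem integrable_integral_process (hX : Measurable (Function.uncurry X)) (hΦ : Measurable Φ)
    (hΦX : HasFiniteOccupation P X Φ) (hh : Measurable h) (hC : ∀ x, |h x| ≤ C * Φ x)
    {s t : ℝ≥0} (hst : s ≤ t) :
    Integrable (fun ω => ∫ u in (s : ℝ)..t, h (X u.toNNReal ω)) P := by
  simpa using integrable_mul_integral_process hX hΦ hΦX hh hC (ξ := fun _ => 1) (c := 1)
    measurable_const (by simp) hst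

theorem integral_mul_integral_process (hX : Measurable (Function.uncurry X)) (hΦ : Measurable Φ)
    (hΦX : HasFiniteOccupation P X Φ) (hh : Measurable h) (hC : ∀ x, |h x| ≤ C * Φ x)
    {ξ : Ω → ℝ} (hξ : Measurable ξ) {c : ℝ} (hc : ∀ ω, ‖ξ ω‖ ≤ c) {s t : ℝ≥0} (hst : s ≤ t) :
    ∫ ω, (ξ ω * ∫ u in (s : ℝ)..t, h (X u.toNNReal ω)) ∂P =
      ∫ u in (s : ℝ)..t, (∫ ω, ξ ω * h (X u.toNNReal ω) ∂P) := by
  have hst' : (s : ℝ) ≤ t := by exact_mod_cast hst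
  have h1 := integrable_mul_process_prod hX hΦ hΦX hh hC hξ hc s t
  simp_rw [intervalIntegral.integral_of_le hst', ← integral_const_mul]
  exact integral_integral_swap (f := fun (ω : Ω) (u : ℝ) => ξ ω * h (X u.toNNReal ω)) h1

theorem integrable_martingalePart (hX : Measurable (Function.uncurry X)) (hΦ : Measurable Φ)
    (hΦX : HasFiniteOccupation P X Φ) (hh : Measurable h) (hC : ∀ x, |h x| ≤ C * Φ x)
    {f : E → ℝ} (hf : Measurable f) {K : ℝ} (hK : ∀ x, ‖f x‖ ≤ K) (t : ℝ≥0) :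
    Integrable (fun ω => f (X t ω) - ∫ u in (0 : ℝ)..t, h (X u.toNNReal ω)) P := by
  refine Integrable.sub (Integrable.of_bound
    (hf.comp (measurable_process_apply hX t)).aestronglyMeasurable K
    (Eventually.of_forall fun ω => hK _)) ?_
  simpa using integrable_integral_process hX hΦ hΦX hh hC (s := 0) zero_le (t := t)

/-- The expectation of a bounded weight times an increment of `f(X_t) - ∫_0^t h(X_u) du`. -/
theorem integral_mul_martingalePart_sub (hX : Measurable (Function.uncurry X)) (hΦ : Measurable Φ)
    (hΦX : HasFiniteOccupation P X Φ) (hh : Measurable h) (hC : ∀ x, |h x| ≤ C * Φ x)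
    {f : E → ℝ} (hf : Measurable f) {K : ℝ} (hK : ∀ x, ‖f x‖ ≤ K)
    {ξ : Ω → ℝ} (hξ : Measurable ξ) {c : ℝ} (hc : ∀ ω, ‖ξ ω‖ ≤ c) {s t : ℝ≥0} (hst : s ≤ t) :
    ∫ ω, ξ ω * (f (X t ω) - ∫ u in (0 : ℝ)..t, h (X u.toNNReal ω)) ∂P -
      ∫ ω, ξ ω * (f (X s ω) - ∫ u in (0 : ℝ)..s, h (X u.toNNReal ω)) ∂P =
    ∫ ω, ξ ω * f (X t ω) ∂P - ∫ ω, ξ ω * f (X s ω) ∂P -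
      ∫ u in (s : ℝ)..t, (∫ ω, ξ ω * h (X u.toNNReal ω) ∂P) := by
  have hM := fun t => (integrable_martingalePart hX hΦ hΦX hh hC hf hK t).bdd_mul
    hξ.aestronglyMeasurable (Eventually.of_forall hc)
  have hF : ∀ t, Integrable (fun ω => ξ ω * f (X t ω)) P := fun t =>
    Integrable.bdd_mul (Integrable.of_bound
      (hf.comp (measurable_process_apply hX t)).aestronglyMeasurable K
      (Eventually.of_forall fun ω => hK _)) hξ.aestronglyMeasurable (Eventually.of_forall hc)
  have hI := integrable_mul_integral_process hX hΦ hΦX hh hC hξ hc hst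
  rw [← integral_mul_integral_process hX hΦ hΦX hh hC hξ hc hst, ← integral_sub (hM t) (hM s),
    ← integral_sub (hF t) (hF s), ← integral_sub (by exact (hF t).sub (hF s)) hI]
  refine integral_congr_ae ?_
  filter_upwards [ae_intervalIntegrable_process hX hΦ hΦX hh hC 0 s,
    ae_intervalIntegrable_process hX hΦ hΦX hh hC s t] with ω h1 h2
  have h3 := intervalIntegral.integral_add_adjacent_intervals h1 h2
  rw [NNReal.coe_zero] at h3
  rw [← h3]
  ring

end OccupationIntegrals

/-! ### Laws of solutions satisfy the identities -/

section Solutions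

variable {E : Type*} [MetricSpace E] [SecondCountableTopology E] [MeasurableSpace E] [BorelSpace E]
variable {Ω : Type*} {mΩ : MeasurableSpace Ω} {P : Measure Ω} {X : ℝ≥0 → Ω → E}
  {𝒟 : Set (E →ᵇ ℝ)} {A : 𝒟 → E → ℝ} {Φ : E → ℝ≥0}

theorem NNReal.coe_nnratCast (q : ℚ≥0) : ((q : ℝ≥0) : ℝ) = q := rfl

omit [SecondCountableTopology E] [BorelSpace E] in
theorem measurable_starSigma_apply {u t : ℝ≥0} (hut : u ≤ t) :
    Measurable[starSigma X t] (X u) :=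
  (comap_measurable (X u)).mono (le_sup_left.trans (le_iSup₂_of_le u hut le_rfl)) le_rfl

theorem MeasureTheory.Martingale.integral_mul_eq {ι Ω : Type*} [Preorder ι] {m0 : MeasurableSpace Ω}
    {P : Measure Ω} [IsFiniteMeasure P] {ℱ : Filtration ι m0} {M : ι → Ω → ℝ}
    (hM : Martingale M ℱ P) {s t : ι} (hst : s ≤ t) {ξ : Ω → ℝ}
    (hξ : StronglyMeasurable[ℱ s] ξ) {c : ℝ} (hc : ∀ ω, ‖ξ ω‖ ≤ c) :
    ∫ ω, ξ ω * M t ω ∂P = ∫ ω, ξ ω * M s ω ∂P := by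
  have h1 := condExp_stronglyMeasurable_mul_of_bound (ℱ.le s) hξ (hM.integrable t) c
    (Eventually.of_forall hc)
  rw [← integral_condExp (ℱ.le s)]
  refine integral_congr_ae (h1.trans ?_)
  filter_upwards [hM.2 s t hst] with ω hω
  rw [Pi.mul_apply, hω]

omit [MetricSpace E] [SecondCountableTopology E] [BorelSpace E] in
theorem measurable_prod_process {m : MeasurableSpace Ω} {k : ℕ} {g : Fin k → E → ℝ}
    (hg : ∀ i, Measurable (g i)) {r : Fin k → ℝ≥0} (hX : ∀ i, Measurable[m] (X (r i))) :
    Measurable[m] fun ω => ∏ i, g i (X (r i) ω) :=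
  Finset.measurable_prod _ fun i _ => (hg i).comp (hX i)

omit [MetricSpace E] [SecondCountableTopology E] [MeasurableSpace E] [BorelSpace E] in
theorem norm_prod_apply_le {k : ℕ} {g : Fin k → E → ℝ} {K : Fin k → ℝ} (hK : ∀ i x, ‖g i x‖ ≤ K i)
    (y : Fin k → E) : ‖∏ i, g i (y i)‖ ≤ ∏ i, K i := by
  rw [norm_prod]
  exact Finset.prod_le_prod (fun _ _ => norm_nonneg _) fun i _ => hK i _

theorem HasFiniteDimLaws.lintegral_occupation {μ : ConsistentFamilies E} [SFinite P]
    (hμ : HasFiniteDimLaws P X μ) (hX : Measurable (Function.uncurry X)) (hΦ : Measurable Φ)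
    (T : ℝ) :
    ∫⁻ s in Ioc (0 : ℝ) T, ∫⁻ x, (Φ (x 0) : ℝ≥0∞) ∂(lawAt μ 0 (fun _ => s.toNNReal)) =
      ∫⁻ ω, (∫⁻ s in Ioc (0 : ℝ) T, (Φ (X s.toNNReal ω) : ℝ≥0∞)) ∂P := by
  have h0 : Measurable fun x : Fin (0 + 1) → E => (Φ (x 0) : ℝ≥0∞) := by fun_prop
  simp_rw [← hμ 0, lintegral_map h0 (measurable_pi_lambda _ fun _ => measurable_process_apply hX _)]
  refine lintegral_lintegral_swap (f := fun (s : ℝ) ω => (Φ (X s.toNNReal ω) : ℝ≥0∞)) ?_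
  have h1 : Measurable fun p : ℝ × Ω => X p.1.toNNReal p.2 :=
    (measurable_process_prod hX).comp measurable_swap
  exact (hΦ.comp h1).coe_nnreal_ennreal.aemeasurable

/-- Since `r i ≤ s`, the weight `∏ g_i(X_{r_i})` is bounded and `*ℱ^X_s`-measurable, hence
orthogonal to the martingale increment over `(s, t]`. -/
theorem IsSolution.mem_solutionLaws [IsProbabilityMeasure P] (hA : ∀ f, Measurable (A f))
    (hΦ : Measurable Φ) (hAΦ : IsDominated A Φ) (hsol : IsSolution A Φ P X)
    {μ : ConsistentFamilies E} (hμ : HasFiniteDimLaws P X μ) (𝒻 : Set 𝒟) (𝒢 : Set (E →ᵇ ℝ)) :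
    μ ∈ solutionLaws A Φ 𝒻 𝒢 := by
  obtain ⟨ν, hX, -, hΦX, hM⟩ := hsol
  refine ⟨fun N => ?_, fun k _ g _ f _ r s t hr hst => ?_⟩
  · rw [hμ.lintegral_occupation hX hΦ]
    exact_mod_cast hΦX N
  · obtain ⟨C, hC⟩ := hAΦ f
    have hXt := measurable_process_apply hX
    simp_rw [hμ.integral_tensorFun hXt g (hA f),
      hμ.integral_tensorFun hXt g (f : E →ᵇ ℝ).continuous.measurable]
    have hst' : (s : ℝ≥0) ≤ (t : ℝ≥0) := by exact_mod_cast hst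
    have hξ : Measurable[starSigma X s] fun ω => ∏ i, g i (X (r i) ω) :=
      measurable_prod_process (fun i => (g i).continuous.measurable) fun i =>
        measurable_starSigma_apply (by exact_mod_cast hr i)
    have hξb : ∀ ω, ‖∏ i, g i (X (r i) ω)‖ ≤ ∏ i, ‖g i‖ := fun ω =>
      norm_prod_apply_le (fun i x => (g i).norm_coe_le_norm x) fun i => X (r i) ω
    have h1 := integral_mul_martingalePart_sub hX hΦ hΦX (hA f) hC
      (f : E →ᵇ ℝ).continuous.measurable (f : E →ᵇ ℝ).norm_coe_le_norm
      (hξ.mono ((starFiltration X hX).le s) le_rfl) hξb hst'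
    rw [(hM f).integral_mul_eq hst' hξ.stronglyMeasurable hξb, sub_self] at h1
    simp only [NNReal.coe_nnratCast] at h1
    linarith

end Solutions

/-! ### Marginals of a consistent family -/

section Reindexing

variable {E : Type*} [MetricSpace E] [SecondCountableTopology E] [MeasurableSpace E] [BorelSpace E]

theorem map_perm_lawAt (μ : ConsistentFamilies E) (m : ℕ) (π : Equiv.Perm (Fin (m + 1)))
    (t : Fin (m + 1) → ℝ≥0) :
    (lawAt μ m t).map (fun x i => x (π i)) = lawAt μ m (fun i => t (π i)) := by
  have hπ : Continuous fun x : Fin (m + 1) → E => fun i => x (π i) := by fun_prop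
  have : IsFiniteMeasure ((lawAt μ m t).map fun x i => x (π i)) :=
    Measure.isFiniteMeasure_map _ _
  refine ext_of_forall_integral_eq_of_IsFiniteMeasure fun f => ?_
  rw [integral_map hπ.measurable.aemeasurable f.continuous.measurable.aestronglyMeasurable]
  exact (μ.1 m).2 π f t

theorem map_castSucc_lawAt (μ : ConsistentFamilies E) (m : ℕ) (t : Fin (m + 2) → ℝ≥0) :
    (lawAt μ (m + 1) t).map (fun x (i : Fin (m + 1)) => x i.castSucc) =
      lawAt μ m fun i => t i.castSucc :=
  μ.2.1 m t

theorem map_castLE_lawAt (μ : ConsistentFamilies E) {m n : ℕ} (hmn : m ≤ n)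
    (t : Fin (n + 1) → ℝ≥0) :
    (lawAt μ n t).map (fun x i => x (Fin.castLE (Nat.succ_le_succ hmn) i)) =
      lawAt μ m fun i => t (Fin.castLE (Nat.succ_le_succ hmn) i) := by
  induction n, hmn using Nat.le_induction with
  | base => simp
  | succ n hmn ih =>
    have h := ih fun i => t i.castSucc
    rw [← map_castSucc_lawAt, Measure.map_map (by fun_prop) (by fun_prop)] at h
    exact h

/-- An injection of indices is an initial inclusion followed by a permutation, so consistency and
symmetry suffice. -/
theorem map_injective_lawAt (μ : ConsistentFamilies E) {m n : ℕ} {φ : Fin (m + 1) → Fin (n + 1)}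
    (hφ : Function.Injective φ) (t : Fin (n + 1) → ℝ≥0) :
    (lawAt μ n t).map (fun x i => x (φ i)) = lawAt μ m fun i => t (φ i) := by
  have hmn : m ≤ n := by
    have := Fintype.card_le_of_injective φ hφ
    simpa using this
  have hc : Function.Injective (Fin.castLE (Nat.succ_le_succ hmn)) := Fin.castLE_injective _
  obtain ⟨π, hπ⟩ : ∃ π : Equiv.Perm (Fin (n + 1)),
      ∀ i, π (Fin.castLE (Nat.succ_le_succ hmn) i) = φ i := by
    let e : range (Fin.castLE (Nat.succ_le_succ hmn)) ≃ range φ :=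
      (Equiv.ofInjective _ hc).symm.trans (Equiv.ofInjective φ hφ)
    refine ⟨e.extendSubtype, fun i => ?_⟩
    rw [Equiv.extendSubtype_apply_of_mem _ _ (mem_range_self i)]
    simp [e]
  have h1 := map_castLE_lawAt μ hmn fun i => t (π i)
  rw [← map_perm_lawAt, Measure.map_map (by fun_prop) (by fun_prop)] at h1
  simpa [Function.comp_def, hπ] using h1

theorem ae_eq_of_times_eq (μ : ConsistentFamilies E) {n : ℕ} (t : Fin (n + 1) → ℝ≥0)
    {i j : Fin (n + 1)} (hij : t i = t j) : ∀ᵐ x ∂(lawAt μ n t), x i = x j := by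
  rcases eq_or_ne i j with rfl | hne
  · simp
  have hinj : Function.Injective ![i, j] := by
    intro a b
    fin_cases a <;> fin_cases b <;> simp [hne, hne.symm]
  have h1 := map_injective_lawAt μ (m := 1) hinj t
  have h2 : (fun a => t (![i, j] a)) = fun _ => t i := by
    funext a
    fin_cases a <;> simp [hij]
  have hd : IsClosed {x : Fin 2 → E | x 0 = x 1} := isClosed_eq (by fun_prop) (by fun_prop)
  have h3 : lawAt μ 1 (fun _ => t i) {x | x 0 = x 1}ᶜ = 0 := by
    rw [prob_compl_eq_zero_iff hd.measurableSet]
    exact μ.2.2 (t i)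
  rw [← h2, ← h1, Measure.map_apply (by fun_prop) hd.measurableSet.compl] at h3
  exact h3

/-- When `φ` repeats indices, symmetry and consistency are not enough and the diagonal condition
enters. Under the law at the concatenated times `(t, t ∘ φ)`, both blocks are marginals along
injections, and the second is almost surely the first reindexed by `φ`. -/
theorem map_lawAt (μ : ConsistentFamilies E) {m n : ℕ} (φ : Fin (m + 1) → Fin (n + 1))
    (t : Fin (n + 1) → ℝ≥0) :
    (lawAt μ n t).map (fun x i => x (φ i)) = lawAt μ m fun i => t (φ i) := by
  let T : Fin ((n + 1 + m) + 1) → ℝ≥0 :=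
    fun i => Fin.append t (fun i => t (φ i)) (Fin.cast (by omega) i)
  let a : Fin (n + 1) → Fin ((n + 1 + m) + 1) := fun i => Fin.cast (by omega) (Fin.castAdd (m + 1) i)
  let b : Fin (m + 1) → Fin ((n + 1 + m) + 1) := fun i => Fin.cast (by omega) (Fin.natAdd (n + 1) i)
  have ha : Function.Injective a := (Fin.cast_injective _).comp (Fin.castAdd_injective _ _)
  have hb : Function.Injective b := (Fin.cast_injective _).comp (Fin.natAdd_injective _ _)
  have hTa : ∀ i, T (a i) = t i := fun i => by simp [T, a]
  have hTb : ∀ i, T (b i) = t (φ i) := fun i => by simp [T, b]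
  have h1 := map_injective_lawAt μ ha T
  have h2 := map_injective_lawAt μ hb T
  simp only [hTa, hTb] at h1 h2
  rw [← h1, ← h2, Measure.map_map (by fun_prop) (by fun_prop)]
  refine Measure.map_congr ?_
  have h3 : ∀ i, ∀ᵐ x ∂(lawAt μ _ T), x (a (φ i)) = x (b i) := fun i =>
    ae_eq_of_times_eq μ T ((hTa _).trans (hTb i).symm)
  filter_upwards [ae_all_iff.2 h3] with x hx
  exact funext hx

end Reindexing

/-! ### Kolmogorov extension at rational times -/

section KolmogorovExtension

open Preorder ProbabilityTheory

/-- The Kolmogorov extension theorem for sequences in a standard Borel space. -/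
theorem exists_measure_map_frestrictLe_eq {E : Type*} [MeasurableSpace E] [StandardBorelSpace E]
    [Nonempty E] (ν : ∀ n : ℕ, Measure (Finset.Iic n → E)) [∀ n, IsProbabilityMeasure (ν n)]
    (hν : ∀ n, (ν (n + 1)).map (frestrictLe₂ (π := fun _ => E) n.le_succ) = ν n) :
    ∃ P : Measure (ℕ → E), IsProbabilityMeasure P ∧
      ∀ n, P.map (frestrictLe (π := fun _ => E) n) = ν n := by
  have hlast : ∀ n, n + 1 ∈ Finset.Iic (n + 1) := fun n => Finset.mem_Iic.2 le_rfl
  let pr : ∀ n, (Finset.Iic (n + 1) → E) → (Finset.Iic n → E) × E := fun n x =>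
    (frestrictLe₂ (π := fun _ => E) n.le_succ x, x ⟨n + 1, hlast n⟩)
  have hpr : ∀ n, Measurable (pr n) := fun n =>
    (measurable_frestrictLe₂ (X := fun _ => E) _).prodMk (measurable_pi_apply _)
  have hprob : ∀ n, IsProbabilityMeasure ((ν (n + 1)).map (pr n)) := fun n =>
    Measure.isProbabilityMeasure_map (hpr n).aemeasurable
  -- Disintegrating `ν (n + 1)` over its first coordinates gives transition kernels for the
  -- Ionescu-Tulcea construction.
  let κ : ∀ n, Kernel (Finset.Iic n → E) E := fun n => ((ν (n + 1)).map (pr n)).condKernel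
  have hκ : ∀ n, IsMarkovKernel (κ n) := fun n => by
    dsimp only [κ]
    infer_instance
  let μ₀ : Measure E := (ν 0).map fun x => x ⟨0, by simp⟩
  have hμ₀ : IsProbabilityMeasure μ₀ := Measure.isProbabilityMeasure_map
    (measurable_pi_apply _).aemeasurable
  let P : Measure (ℕ → E) := Kernel.trajMeasure (X := fun _ => E) μ₀ κ
  refine ⟨P, inferInstance, fun n => ?_⟩
  induction n with
  | zero =>
    have h1 : P.map (frestrictLe (π := fun _ => E) 0) =
        μ₀.map (MeasurableEquiv.piUnique fun _ : Finset.Iic 0 => E).symm := by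
      dsimp only [P]
      rw [Kernel.trajMeasure, Measure.map_comp _ _ (by fun_prop), Kernel.traj_map_frestrictLe,
        Kernel.partialTraj_self, Measure.id_comp]
    rw [h1, Measure.map_map (by fun_prop) (by fun_prop)]
    convert Measure.map_id
    ext x i
    have hi : i = ⟨0, by simp⟩ := Subsingleton.elim _ _
    subst hi
    rfl
  | succ n ih =>
    let J : (Finset.Iic n → E) × E → Finset.Iic (n + 1) → E := fun p i =>
      if h : i.1 ≤ n then p.1 ⟨i.1, Finset.mem_Iic.2 h⟩ else p.2
    have hJ : Measurable J := by
      refine measurable_pi_lambda _ fun i => ?_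
      by_cases h : i.1 ≤ n
      · simp only [J, h, dite_true]
        fun_prop
      · simp only [J, h, dite_false]
        fun_prop
    have hJpr : J ∘ pr n = id := by
      funext x
      funext i
      by_cases h : i.1 ≤ n
      · simp [J, pr, h]
      · have hi : i = ⟨n + 1, hlast n⟩ :=
          Subtype.ext (le_antisymm (Finset.mem_Iic.1 i.2) (not_le.1 h))
        subst hi
        simp [J, pr]
    have h1 : frestrictLe (π := fun _ => E) (n + 1) =
        J ∘ fun x : ℕ → E => (frestrictLe (π := fun _ => E) n x, x (n + 1)) := by
      funext x
      exact (congrFun hJpr (frestrictLe (π := fun _ => E) (n + 1) x)).symm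
    have h2 : ((ν (n + 1)).map (pr n)).fst = ν n := by
      rw [Measure.fst, Measure.map_map measurable_fst (hpr n)]
      exact hν n
    have h3 : P.map (fun x : ℕ → E => (frestrictLe (π := fun _ => E) n x, x (n + 1))) =
        (ν (n + 1)).map (pr n) := by
      have h4 := Kernel.map_frestrictLe_trajMeasure_compProd_eq_map_trajMeasure
        (X := fun _ => E) (κ := κ) (μ₀ := μ₀) (a := n)
      change P.map _ ⊗ₘ _ = P.map _ at h4
      rw [← h4, ih]
      conv_lhs => rw [← h2]
      exact Measure.disintegrate _ _
    rw [h1, ← Measure.map_map hJ (by fun_prop), h3, Measure.map_map hJ (hpr n), hJpr,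
      Measure.map_id]

theorem exists_measure_map_fin_eq {E : Type*} [MeasurableSpace E] [StandardBorelSpace E]
    [Nonempty E] (ρ : ∀ n : ℕ, Measure (Fin (n + 1) → E)) [∀ n, IsProbabilityMeasure (ρ n)]
    (hρ : ∀ n, (ρ (n + 1)).map (fun x (i : Fin (n + 1)) => x i.castSucc) = ρ n) :
    ∃ P : Measure (ℕ → E), IsProbabilityMeasure P ∧
      ∀ n, P.map (fun x (i : Fin (n + 1)) => x i) = ρ n := by
  let R : ∀ n, (Fin (n + 1) → E) → Finset.Iic n → E := fun n x i =>
    x ⟨i.1, Nat.lt_succ_of_le (Finset.mem_Iic.1 i.2)⟩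
  let S : ∀ n, (Finset.Iic n → E) → Fin (n + 1) → E := fun n x i =>
    x ⟨i.1, Finset.mem_Iic.2 (Nat.le_of_lt_succ i.2)⟩
  have hR : ∀ n, Measurable (R n) := fun n => by fun_prop
  have hS : ∀ n, Measurable (S n) := fun n => by fun_prop
  have hprob : ∀ n, IsProbabilityMeasure ((ρ n).map (R n)) := fun n =>
    Measure.isProbabilityMeasure_map (hR n).aemeasurable
  obtain ⟨P, hP, hPn⟩ := exists_measure_map_frestrictLe_eq (fun n => (ρ n).map (R n)) fun n => by
    rw [Measure.map_map (measurable_frestrictLe₂ (X := fun _ => E) _) (hR _)]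
    conv_rhs => rw [← hρ n]
    rw [Measure.map_map (hR n) (by fun_prop)]
    rfl
  refine ⟨P, hP, fun n => ?_⟩
  have h := congrArg (fun m => m.map (S n)) (hPn n)
  rw [Measure.map_map (hS n) (by fun_prop), Measure.map_map (hS n) (hR n)] at h
  exact h.trans Measure.map_id

universe u v

/-- Existence of a process indexed by rational times with the given finite dimensional laws, on a
probability space in any prescribed universe. -/
theorem exists_process_nnrat {E : Type u} [MetricSpace E] [CompleteSpace E]
    [SecondCountableTopology E] [MeasurableSpace E] [BorelSpace E] (μ : ConsistentFamilies E) :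
    ∃ (Ω : Type v) (_ : MeasurableSpace Ω) (P : Measure Ω) (Y : ℚ≥0 → Ω → E),
      IsProbabilityMeasure P ∧ (∀ r, Measurable (Y r)) ∧
      ∀ (m : ℕ) (t : Fin (m + 1) → ℚ≥0),
        P.map (fun ω i => Y (t i) ω) = lawAt μ m fun i => (t i : ℝ≥0) := by
  have hE : Nonempty E := by
    obtain ⟨x⟩ := ProbabilityMeasure.nonempty ((μ.1 0).1 fun _ => 0)
    exact ⟨x 0⟩
  obtain ⟨q⟩ : Nonempty (ℕ ≃ ℚ≥0) := nonempty_equiv_of_countable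
  obtain ⟨P, hP, hPn⟩ := exists_measure_map_fin_eq
    (fun n => lawAt μ n fun i : Fin (n + 1) => (q i : ℝ≥0)) fun n => map_castSucc_lawAt μ n _
  -- Representing `P` as an image of Lebesgue measure on the unit interval allows the sample space
  -- to be lifted to any universe.
  obtain ⟨f, hf, hfP⟩ := P.exists_measurable_map_eq
  have hg : Measurable fun ω : ULift.{v} unitInterval => f ω.down := hf.comp measurable_down
  refine ⟨ULift.{v} unitInterval, inferInstance, (volume : Measure unitInterval).map ULift.up,
    fun r ω => f ω.down (q.symm r), Measure.isProbabilityMeasure_map measurable_up.aemeasurable,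
    fun r => (measurable_pi_apply _).comp hg, fun m t => ?_⟩
  obtain ⟨n, hn⟩ : ∃ n, ∀ i, q.symm (t i) < n + 1 := by
    refine ⟨∑ i, q.symm (t i), fun i => Nat.lt_succ_of_le ?_⟩
    exact Finset.single_le_sum (f := fun i => q.symm (t i)) (fun _ _ => Nat.zero_le _)
      (Finset.mem_univ i)
  -- The times `t i` may repeat, so the index map need not be injective.
  have h1 := map_lawAt μ (fun i => (⟨q.symm (t i), hn i⟩ : Fin (n + 1)))
    fun i : Fin (n + 1) => (q i : ℝ≥0)
  simp only [Equiv.apply_symm_apply] at h1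
  have hY : Measurable fun (ω : ULift.{v} unitInterval) i => f ω.down (q.symm (t i)) :=
    measurable_pi_lambda _ fun i => (measurable_pi_apply _).comp hg
  rw [← h1, ← hPn, ← hfP, Measure.map_map hY measurable_up, Measure.map_map (by fun_prop) hf,
    Measure.map_map (by fun_prop) (by fun_prop)]
  rfl

end KolmogorovExtension

/-! ### Factorial time grids -/

section RatFloor

/-- The largest multiple of `1 / n!` that is at most `t`. -/
def ratFloor (n : ℕ) (t : ℝ≥0) : ℚ≥0 := (⌊(n.factorial : ℝ≥0) * t⌋₊ : ℚ≥0) / n.factorial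

theorem ratFloor_le (n : ℕ) (t : ℝ≥0) : (ratFloor n t : ℝ≥0) ≤ t := by
  have h0 : (0 : ℝ≥0) < n.factorial := by exact_mod_cast n.factorial_pos
  rw [ratFloor]
  push_cast
  rw [div_le_iff₀ h0, mul_comm]
  exact Nat.floor_le zero_le

theorem lt_ratFloor_add (n : ℕ) (t : ℝ≥0) : t < (ratFloor n t : ℝ≥0) + 1 / n.factorial := by
  have h0 : (0 : ℝ≥0) < n.factorial := by exact_mod_cast n.factorial_pos
  rw [ratFloor]
  push_cast
  rw [← add_div, lt_div_iff₀ h0, mul_comm]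
  exact Nat.lt_floor_add_one _

theorem tendsto_one_div_factorial : Tendsto (fun n : ℕ => (1 : ℝ≥0) / n.factorial) atTop (𝓝 0) := by
  rw [← NNReal.tendsto_coe]
  have h := FloorSemiring.tendsto_pow_div_factorial_atTop (1 : ℝ)
  simpa using h

theorem dist_ratFloor_le (n : ℕ) (t : ℝ≥0) :
    dist (ratFloor n t : ℝ≥0) t ≤ ((1 / n.factorial : ℝ≥0) : ℝ) := by
  have h1 : ((ratFloor n t : ℝ≥0) : ℝ) ≤ t := ratFloor_le n t
  have h2 : (t : ℝ) < (ratFloor n t : ℝ≥0) + ((1 / n.factorial : ℝ≥0) : ℝ) :=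
    lt_ratFloor_add n t
  rw [NNReal.dist_eq, abs_le]
  constructor <;> linarith [(1 / n.factorial : ℝ≥0).coe_nonneg]

theorem tendsto_ratFloor (t : ℝ≥0) :
    Tendsto (fun n => (ratFloor n t : ℝ≥0)) atTop (𝓝 t) := by
  refine tendsto_iff_dist_tendsto_zero.2 (squeeze_zero (fun _ => dist_nonneg)
    (fun n => dist_ratFloor_le n t) ?_)
  exact NNReal.tendsto_coe.2 tendsto_one_div_factorial

/-- This is what factorial denominators are for: each rational eventually lies on every grid, so
limits along the grids do not alter the process at rational times. -/
theorem ratFloor_ratCast {n : ℕ} {q : ℚ≥0} (h : q.den ≤ n) : ratFloor n q = q := by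
  obtain ⟨k, hk⟩ := Nat.dvd_factorial q.den_pos h
  have h0 : (n.factorial : ℚ≥0) ≠ 0 := by exact_mod_cast n.factorial_ne_zero
  have h1 : (n.factorial : ℚ≥0) * q = (k * q.num : ℕ) := by
    have h2 : (q.den : ℚ≥0) * q = q.num := NNRat.den_mul_eq_num q
    rw [hk]
    push_cast
    rw [← h2]
    ring
  have h3 : ((n.factorial : ℝ≥0) * (q : ℝ≥0)) = ((k * q.num : ℕ) : ℝ≥0) := by exact_mod_cast h1
  rw [ratFloor, h3, Nat.floor_natCast, ← h1, mul_div_cancel_left₀ _ h0]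

theorem ratFloor_mono (n : ℕ) {s t : ℝ≥0} (hst : s ≤ t) : ratFloor n s ≤ ratFloor n t := by
  unfold ratFloor
  gcongr

end RatFloor

/-! ### Uniform continuity in probability -/

section PairDistance

variable {E : Type*} [MetricSpace E] [SecondCountableTopology E] [MeasurableSpace E] [BorelSpace E]

/-- The truncated distance `min 1 d(x_0, x_1)`. -/
def cutDist (E : Type*) [MetricSpace E] : (Fin 2 → E) →ᵇ ℝ :=
  BoundedContinuousFunction.ofNormedAddCommGroup (fun x => min 1 (dist (x 0) (x 1)))
    (by fun_prop) 1 (fun x => by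
      rw [Real.norm_eq_abs, abs_of_nonneg (le_min zero_le_one dist_nonneg)]
      exact min_le_left _ _)

omit [SecondCountableTopology E] [MeasurableSpace E] [BorelSpace E] in
theorem cutDist_apply (x : Fin 2 → E) : cutDist E x = min 1 (dist (x 0) (x 1)) := rfl

omit [SecondCountableTopology E] [MeasurableSpace E] [BorelSpace E] in
theorem cutDist_nonneg (x : Fin 2 → E) : 0 ≤ cutDist E x := le_min zero_le_one dist_nonneg

/-- The mean truncated distance of the coordinates under `μ^2(t_0, t_1)`. -/
def pairDist (μ : ConsistentFamilies E) (t : Fin 2 → ℝ≥0) : ℝ := ∫ x, cutDist E x ∂(lawAt μ 1 t)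

theorem continuous_integral_lawAt (μ : ConsistentFamilies E) (m : ℕ) (f : (Fin (m + 1) → E) →ᵇ ℝ) :
    Continuous fun t => ∫ x, f x ∂(lawAt μ m t) :=
  (ProbabilityMeasure.continuous_integral_boundedContinuousFunction f).comp (μ.1 m).1.continuous

theorem pairDist_self (μ : ConsistentFamilies E) {t : Fin 2 → ℝ≥0} (ht : t 0 = t 1) :
    pairDist μ t = 0 := by
  refine integral_eq_zero_of_ae ?_
  filter_upwards [ae_eq_of_times_eq μ (n := 1) t ht] with x hx
  simp [cutDist_apply, hx]

theorem lintegral_min_dist_eq {Ω : Type*} {mΩ : MeasurableSpace Ω} {P : Measure Ω}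
    {μ : ConsistentFamilies E} {Z : Fin 2 → Ω → E} (hZ : ∀ i, Measurable (Z i)) {t : Fin 2 → ℝ≥0}
    (h : P.map (fun ω i => Z i ω) = lawAt μ 1 t) :
    ∫⁻ ω, ENNReal.ofReal (min 1 (dist (Z 0 ω) (Z 1 ω))) ∂P = ENNReal.ofReal (pairDist μ t) := by
  rw [pairDist, ofReal_integral_eq_lintegral_ofReal ((cutDist E).integrable _)
    (Eventually.of_forall cutDist_nonneg), ← h,
    lintegral_map (by fun_prop) (measurable_pi_lambda _ hZ)]
  rfl

/-- `pairDist μ` is uniformly continuous on the compact square and vanishes on the diagonal. -/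
theorem exists_forall_pairDist_le (μ : ConsistentFamilies E) (T : ℝ≥0) {ε : ℝ} (hε : 0 < ε) :
    ∃ δ > 0, ∀ t : Fin 2 → ℝ≥0, (∀ i, t i ≤ T) → dist (t 0) (t 1) < δ → pairDist μ t ≤ ε := by
  have hK : IsCompact (Icc (fun _ => 0) (fun _ => T) : Set (Fin 2 → ℝ≥0)) := isCompact_Icc
  have hu := hK.uniformContinuousOn_of_continuous
    (continuous_integral_lawAt μ 1 (cutDist E)).continuousOn
  obtain ⟨δ, hδ, h⟩ := Metric.uniformContinuousOn_iff.1 hu ε hε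
  refine ⟨δ, hδ, fun t ht hd => ?_⟩
  have h1 := h t ⟨fun _ => zero_le, ht⟩ (fun _ => t 0) ⟨fun _ => zero_le, fun _ => ht 0⟩ (by
    rw [dist_pi_lt_iff hδ]
    intro i
    fin_cases i
    · simpa using hδ
    · simpa [dist_comm] using hd)
  have h2 : pairDist μ (fun _ => t 0) = 0 := pairDist_self μ rfl
  change dist (pairDist μ t) (pairDist μ fun _ => t 0) < ε at h1
  rw [h2, dist_zero_right, Real.norm_eq_abs] at h1
  exact (le_abs_self _).trans h1.le

/-- A subsequence of the grids `(1/n!) ℕ` along which consecutive discretizations of time give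
summable mean distances, locally uniformly. -/
theorem exists_seq_pairDist_le (μ : ConsistentFamilies E) :
    ∃ n : ℕ → ℕ, Tendsto n atTop atTop ∧ ∀ (k : ℕ) (t : ℝ≥0), t ≤ k →
      pairDist μ ![ratFloor (n k) t, ratFloor (n (k + 1)) t] ≤ (1 / 2) ^ k := by
  have h1 : ∀ k : ℕ, ∃ N : ℕ, ∀ n n', N ≤ n → N ≤ n' → ∀ t : ℝ≥0, t ≤ k →
      pairDist μ ![ratFloor n t, ratFloor n' t] ≤ (1 / 2) ^ k := by
    intro k
    obtain ⟨δ, hδ, hd⟩ := exists_forall_pairDist_le μ k (show (0 : ℝ) < (1 / 2) ^ k by positivity)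
    have h2 : Tendsto (fun n : ℕ => ((1 / n.factorial : ℝ≥0) : ℝ)) atTop (𝓝 0) :=
      NNReal.tendsto_coe.2 tendsto_one_div_factorial
    obtain ⟨N, hN⟩ := eventually_atTop.1 (h2.eventually_lt_const (half_pos hδ))
    refine ⟨N, fun n n' hn hn' t ht => hd _ (fun i => ?_) ?_⟩
    · fin_cases i
      · exact (ratFloor_le n t).trans ht
      · exact (ratFloor_le n' t).trans ht
    · change dist (ratFloor n t : ℝ≥0) (ratFloor n' t : ℝ≥0) < δ
      have h3 := dist_triangle_right (ratFloor n t : ℝ≥0) (ratFloor n' t : ℝ≥0) t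
      linarith [dist_ratFloor_le n t, dist_ratFloor_le n' t, hN n hn, hN n' hn']
  choose N hN using h1
  -- Partial sums of the thresholds are monotone, so the indices for `k` and `k + 1` both exceed `N
  -- k`; the summand `k` forces divergence.
  have hle : ∀ k, N k ≤ k + ∑ j ∈ Finset.range (k + 1), N j := fun k =>
    le_add_left (Finset.single_le_sum (f := N) (fun _ _ => Nat.zero_le _)
      (Finset.self_mem_range_succ k))
  refine ⟨fun k => k + ∑ j ∈ Finset.range (k + 1), N j,
    tendsto_atTop_mono (fun k => Nat.le_add_right _ _) tendsto_id, fun k t ht => hN k _ _ (hle k) ?_ t ht⟩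
  refine (hle k).trans ?_
  beta_reduce
  rw [Finset.sum_range_succ _ (k + 1)]
  omega

end PairDistance

/-! ### Limits along the grids -/

section Limits

variable {E : Type*} [MetricSpace E] [CompleteSpace E] [MeasurableSpace E] [BorelSpace E]
  [SecondCountableTopology E] {Ω : Type*} {mΩ : MeasurableSpace Ω} {P : Measure Ω}

theorem summable_of_summable_min_one {u : ℕ → ℝ} (h : Summable fun n => min 1 (u n)) :
    Summable u := by
  refine (summable_congr_cofinite ?_).1 h
  rw [Nat.cofinite_eq_atTop]
  filter_upwards [h.tendsto_atTop_zero.eventually_lt_const one_pos] with n hn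
  exact min_eq_right ((min_lt_iff.1 hn).resolve_left (lt_irrefl _)).le

/-- The truncated distances have a finite expected sum from `N` on, so almost every sequence has
summable steps and converges by completeness. -/
theorem ae_exists_tendsto_of_lintegral_min_dist_le {Z : ℕ → Ω → E} (hZ : ∀ n, Measurable (Z n))
    {N : ℕ} (h : ∀ n ≥ N, ∫⁻ ω, ENNReal.ofReal (min 1 (dist (Z n ω) (Z (n + 1) ω))) ∂P ≤
      ENNReal.ofReal ((1 / 2) ^ n)) :
    ∀ᵐ ω ∂P, ∃ z, Tendsto (fun n => Z n ω) atTop (𝓝 z) := by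
  have hm : ∀ n, Measurable fun ω => ENNReal.ofReal (min 1 (dist (Z n ω) (Z (n + 1) ω))) :=
    fun n => (measurable_const.min ((hZ n).dist (hZ (n + 1)))).ennreal_ofReal
  have h1 : ∫⁻ ω, ∑' n, ENNReal.ofReal (min 1 (dist (Z (n + N) ω) (Z (n + N + 1) ω))) ∂P ≠ ∞ := by
    rw [lintegral_tsum fun n => (hm (n + N)).aemeasurable]
    refine ne_top_of_le_ne_top ?_ (ENNReal.tsum_le_tsum fun n => h (n + N) (Nat.le_add_left N n))
    have hs : Summable fun n : ℕ => ((1 : ℝ) / 2) ^ (n + N) :=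
      (summable_nat_add_iff N).2 summable_geometric_two
    rw [← ENNReal.ofReal_tsum_of_nonneg (fun n => by positivity) hs]
    exact ENNReal.ofReal_ne_top
  filter_upwards [ae_lt_top (Measurable.tsum fun n => hm (n + N)) h1] with ω hω
  have h2 := ENNReal.summable_toReal hω.ne
  have h3 : Summable fun n => dist (Z (n + N) ω) (Z (n + N + 1) ω) := by
    refine summable_of_summable_min_one (h2.congr fun n => ?_)
    exact ENNReal.toReal_ofReal (le_min zero_le_one dist_nonneg)
  have h4 : Summable fun n => dist (Z n ω) (Z (n + 1) ω) := (summable_nat_add_iff N).1 h3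
  exact cauchySeq_tendsto_of_complete (cauchySeq_of_summable_dist h4)

/-- The limit of the step processes `Y_{⌊n_k! t⌋ / n_k!}`. -/
def gridLimit [Nonempty E] (n : ℕ → ℕ) (Y : ℚ≥0 → Ω → E) (t : ℝ≥0) (ω : Ω) : E :=
  limUnder atTop fun k => Y (ratFloor (n k) t) ω

omit [CompleteSpace E] [MeasurableSpace E] [BorelSpace E] [SecondCountableTopology E] in
theorem gridLimit_ratCast [Nonempty E] {n : ℕ → ℕ} (hn : Tendsto n atTop atTop)
    (Y : ℚ≥0 → Ω → E) (q : ℚ≥0) : gridLimit n Y q = Y q := by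
  funext ω
  refine Tendsto.limUnder_eq (tendsto_const_nhds.congr' ?_)
  filter_upwards [hn.eventually_ge_atTop q.den] with k hk
  rw [ratFloor_ratCast hk]

omit [MetricSpace E] [CompleteSpace E] [BorelSpace E] [SecondCountableTopology E] in
theorem measurable_ratFloor_process {m : MeasurableSpace Ω} {Y : ℚ≥0 → Ω → E} {τ : ℝ → ℝ≥0}
    (hτ : Measurable τ) (n : ℕ) (hY : ∀ t, Measurable[m] (Y (ratFloor n (τ t)))) :
    Measurable fun p : Ω × ℝ => Y (ratFloor n (τ p.2)) p.1 := by
  classical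
  rcases isEmpty_or_nonempty Ω with hΩ | hΩ
  · exact measurable_of_empty _
  let ω₀ : Ω := Classical.arbitrary Ω
  let e : E := Y (ratFloor n (τ 0)) ω₀
  let j : ℝ → ℕ := fun t => ⌊(n.factorial : ℝ≥0) * τ t⌋₊
  have hj : Measurable j := Nat.measurable_floor.comp (hτ.const_mul _)
  let F : Ω × ℕ → E := fun p =>
    if p.2 ∈ range j then Y ((p.2 : ℚ≥0) / n.factorial) p.1 else e
  have hF : Measurable F := by
    refine measurable_from_prod_countable_left fun i => ?_
    by_cases hi : i ∈ range j
    · obtain ⟨t, rfl⟩ := hi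
      simp only [F, if_pos (mem_range_self t)]
      exact hY t
    · simp only [F, if_neg hi]
      exact measurable_const
  have hFj : (fun p : Ω × ℝ => Y (ratFloor n (τ p.2)) p.1) = fun p => F (p.1, j p.2) := by
    funext p
    simp [F, j, ratFloor]
  rw [hFj]
  exact hF.comp (measurable_fst.prodMk (hj.comp measurable_snd))

theorem measurable_gridLimit [Nonempty E] {m : MeasurableSpace Ω} {Y : ℚ≥0 → Ω → E} {τ : ℝ → ℝ≥0}
    (hτ : Measurable τ) (n : ℕ → ℕ) (hY : ∀ k t, Measurable[m] (Y (ratFloor k (τ t)))) :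
    Measurable fun p : Ω × ℝ => gridLimit n Y (τ p.2) p.1 :=
  (StronglyMeasurable.limUnder fun k =>
    (measurable_ratFloor_process hτ (n k) (hY (n k))).stronglyMeasurable).measurable

/-- The grid floor never exceeds the time, so up to time `s` the limit uses `Y` only at rationals `≤
s`. It is therefore jointly measurable in time and in the σ-field of those values, which also covers
the time integrals. -/
theorem starSigma_gridLimit_le [Nonempty E] {n : ℕ → ℕ} (hn : Tendsto n atTop atTop)
    (Y : ℚ≥0 → Ω → E) (s : ℝ≥0) :
    starSigma (gridLimit n Y) s ≤
      ⨆ (q : ℚ≥0) (_ : (q : ℝ≥0) ≤ s), MeasurableSpace.comap (gridLimit n Y q) inferInstance := by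
  set m : MeasurableSpace Ω :=
    ⨆ (q : ℚ≥0) (_ : (q : ℝ≥0) ≤ s), MeasurableSpace.comap (gridLimit n Y q) inferInstance
  have hY : ∀ q : ℚ≥0, (q : ℝ≥0) ≤ s → Measurable[m] (Y q) := by
    intro q hq
    rw [← gridLimit_ratCast hn Y q]
    exact (comap_measurable _).mono
      (le_iSup₂_of_le (f := fun (q : ℚ≥0) (_ : (q : ℝ≥0) ≤ s) =>
        MeasurableSpace.comap (gridLimit n Y q) inferInstance) q hq le_rfl) le_rfl
  -- Capping time at `s` gives a process on all of `ℝ` that never looks beyond `s`.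
  have hτ : Measurable fun r : ℝ => min r.toNNReal s := measurable_real_toNNReal.min measurable_const
  have hm := measurable_gridLimit (m := m) (Y := Y) hτ n fun k t =>
    hY _ ((ratFloor_le _ _).trans (min_le_right _ _))
  have hX : ∀ u ≤ s, Measurable[m] (gridLimit n Y u) := by
    intro u hu
    have h1 := hm.comp (measurable_prodMk_right (y := (u : ℝ)))
    simpa [Function.comp_def, min_eq_left hu] using h1
  refine iSup₂_le fun u hu => sup_le (hX u hu).comap_le (iSup_le fun h => Measurable.comap_le ?_)
  have h1 : ∀ ω, ∫ r in (0 : ℝ)..u, h (gridLimit n Y r.toNNReal ω) =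
      ∫ r in Ioc (0 : ℝ) u, h (gridLimit n Y (min r.toNNReal s) ω) := by
    intro ω
    rw [intervalIntegral.integral_of_le u.coe_nonneg]
    refine setIntegral_congr_fun measurableSet_Ioc fun r hr => ?_
    have hr' : r.toNNReal ≤ s := (Real.toNNReal_le_iff_le_coe.2 hr.2).trans hu
    simp [min_eq_left hr']
  simp_rw [h1]
  exact (h.continuous.measurable.comp hm).stronglyMeasurable.integral_prod_right'.measurable

end Limits

/-! ### The process with prescribed laws -/

section Construction

universe u v

/-- At each fixed time the discretizations converge almost surely, and weak continuity of `μ`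
identifies the laws of the limit. Continuity in probability follows from Markov's inequality, as
`pairDist μ ![s, t]` tends to `0` when `s → t`. -/
theorem exists_progressive_process {E : Type u} [MetricSpace E] [CompleteSpace E]
    [SecondCountableTopology E] [MeasurableSpace E] [BorelSpace E] (μ : ConsistentFamilies E) :
    ∃ (Ω : Type v) (_ : MeasurableSpace Ω) (P : Measure Ω) (X : ℝ≥0 → Ω → E),
      IsProbabilityMeasure P ∧ Measurable (Function.uncurry X) ∧ IsContinuousInProbability P X ∧
      HasFiniteDimLaws P X μ ∧ ∀ s : ℝ≥0, starSigma X s ≤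
        ⨆ (q : ℚ≥0) (_ : (q : ℝ≥0) ≤ s), MeasurableSpace.comap (X q) inferInstance := by
  have hE : Nonempty E := by
    obtain ⟨x⟩ := ProbabilityMeasure.nonempty ((μ.1 0).1 fun _ => 0)
    exact ⟨x 0⟩
  obtain ⟨Ω, mΩ, P, Y, hP, hY, hlaw⟩ := exists_process_nnrat.{u, v} μ
  obtain ⟨n, hn, hnk⟩ := exists_seq_pairDist_le μ
  have hm : Measurable fun p : Ω × ℝ => gridLimit n Y p.2.toNNReal p.1 :=
    measurable_gridLimit measurable_real_toNNReal n fun _ _ => hY _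
  have hX : Measurable (Function.uncurry (gridLimit n Y)) := by
    have h1 : Measurable fun p : ℝ≥0 × Ω => (p.2, (p.1 : ℝ)) := by fun_prop
    simpa [Function.comp_def, Function.uncurry_def] using hm.comp h1
  have hXt := measurable_process_apply hX
  have hlim : ∀ t, ∀ᵐ ω ∂P, Tendsto (fun k => Y (ratFloor (n k) t) ω) atTop
      (𝓝 (gridLimit n Y t ω)) := by
    intro t
    obtain ⟨N, hN⟩ := exists_nat_ge t
    have h1 := ae_exists_tendsto_of_lintegral_min_dist_le (P := P)
      (Z := fun k => Y (ratFloor (n k) t)) (N := N) (fun k => hY _) fun k hk => by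
        have h2 := lintegral_min_dist_eq (P := P) (μ := μ)
          (Z := fun i => Y (![ratFloor (n k) t, ratFloor (n (k + 1)) t] i)) (fun i => hY _)
          (hlaw 1 ![ratFloor (n k) t, ratFloor (n (k + 1)) t])
        have h3 : (fun i => ((![ratFloor (n k) t, ratFloor (n (k + 1)) t] i : ℚ≥0) : ℝ≥0)) =
            ![(ratFloor (n k) t : ℝ≥0), (ratFloor (n (k + 1)) t : ℝ≥0)] := by
          funext i
          fin_cases i <;> rfl
        rw [h3] at h2
        refine le_trans h2.le (ENNReal.ofReal_le_ofReal (hnk k t (hN.trans ?_)))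
        exact_mod_cast hk
    filter_upwards [h1] with ω hω
    exact tendsto_nhds_limUnder hω
  have hfdd : HasFiniteDimLaws P (gridLimit n Y) μ := by
    intro m t
    have hmeas : Measurable fun ω i => gridLimit n Y (t i) ω := measurable_pi_lambda _ fun i => hXt _
    have : IsFiniteMeasure (P.map fun ω i => gridLimit n Y (t i) ω) :=
      Measure.isFiniteMeasure_map _ _
    refine ext_of_forall_integral_eq_of_IsFiniteMeasure fun f => ?_
    rw [integral_map hmeas.aemeasurable f.continuous.measurable.aestronglyMeasurable]
    have hmk : ∀ k, Measurable fun ω i => Y (ratFloor (n k) (t i)) ω :=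
      fun k => measurable_pi_lambda _ fun i => hY _
    have h1 : Tendsto (fun k => ∫ ω, f (fun i => Y (ratFloor (n k) (t i)) ω) ∂P) atTop
        (𝓝 (∫ ω, f (fun i => gridLimit n Y (t i) ω) ∂P)) := by
      refine tendsto_integral_of_dominated_convergence (fun _ => ‖f‖)
        (fun k => (f.continuous.measurable.comp (hmk k)).aestronglyMeasurable)
        (integrable_const _) (fun k => Eventually.of_forall fun ω => f.norm_coe_le_norm _) ?_
      filter_upwards [ae_all_iff.2 fun i => hlim (t i)] with ω hω
      exact (f.continuous.tendsto _).comp (tendsto_pi_nhds.2 hω)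
    have h2 : Tendsto (fun k => ∫ ω, f (fun i => Y (ratFloor (n k) (t i)) ω) ∂P) atTop
        (𝓝 (∫ x, f x ∂(lawAt μ m t))) := by
      have h3 : Tendsto (fun k (i : Fin (m + 1)) => (ratFloor (n k) (t i) : ℝ≥0)) atTop (𝓝 t) :=
        tendsto_pi_nhds.2 fun i => (tendsto_ratFloor (t i)).comp hn
      refine (((continuous_integral_lawAt μ m f).tendsto t).comp h3).congr fun k => ?_
      have h4 := hlaw m fun i => ratFloor (n k) (t i)
      simp only [Function.comp_apply]
      rw [← h4, integral_map (hmk k).aemeasurable f.continuous.measurable.aestronglyMeasurable]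
    exact tendsto_nhds_unique h1 h2
  refine ⟨Ω, mΩ, P, gridLimit n Y, hP, hX, fun t => ?_, hfdd, starSigma_gridLimit_le hn Y⟩
  rw [tendstoInMeasure_iff_dist]
  intro ε hε
  have hpos : (0 : ℝ) < min 1 ε := lt_min one_pos hε
  have h1 : ∀ s : ℝ≥0, P {ω | ε ≤ dist (gridLimit n Y s ω) (gridLimit n Y t ω)} ≤
      ENNReal.ofReal (pairDist μ ![s, t]) / ENNReal.ofReal (min 1 ε) := by
    intro s
    have h2 := lintegral_min_dist_eq (P := P) (μ := μ)
      (Z := fun i => gridLimit n Y (![s, t] i)) (fun i => hXt _) (hfdd 1 ![s, t])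
    rw [← h2]
    have hms : Measurable fun ω => ENNReal.ofReal (min 1 (dist (gridLimit n Y s ω)
        (gridLimit n Y t ω))) :=
      (measurable_const.min ((hXt s).dist (hXt t))).ennreal_ofReal
    refine le_trans (measure_mono fun ω hω => ?_) (meas_ge_le_lintegral_div hms.aemeasurable
      (by simpa using hpos) ENNReal.ofReal_ne_top)
    exact ENNReal.ofReal_le_ofReal (min_le_min_left 1 hω)
  have h2 : Tendsto (fun s : ℝ≥0 => ENNReal.ofReal (pairDist μ ![s, t]) / ENNReal.ofReal (min 1 ε))
      (𝓝 t) (𝓝 0) := by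
    have h3 : Tendsto (fun s : ℝ≥0 => pairDist μ ![s, t]) (𝓝 t) (𝓝 0) := by
      have h4 : Continuous fun s : ℝ≥0 => (![s, t] : Fin 2 → ℝ≥0) := by fun_prop
      have h5 := ((continuous_integral_lawAt μ 1 (cutDist E)).comp h4).tendsto t
      have h6 : pairDist μ ![t, t] = 0 := pairDist_self μ rfl
      rw [← h6]
      exact h5
    have h7 := ENNReal.Tendsto.div_const (b := ENNReal.ofReal (min 1 ε))
      (ENNReal.tendsto_ofReal h3) (Or.inr (by simpa using hpos))
    simpa using h7
  exact tendsto_of_tendsto_of_tendsto_of_le_of_le tendsto_const_nhds h2 (fun _ => zero_le) h1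

end Construction

/-! ### Adaptedness of time integrals of Borel functions -/

section OccupationMeasure

variable {E : Type*} [MetricSpace E] [SecondCountableTopology E] [MeasurableSpace E] [BorelSpace E]
variable {Ω : Type*} {mΩ : MeasurableSpace Ω} {X : ℝ≥0 → Ω → E}

/-- The occupation measure of the path of `X` up to time `t`. -/
def occupationMeasure (X : ℝ≥0 → Ω → E) (t : ℝ≥0) (ω : Ω) : Measure E :=
  (volume.restrict (Ioc (0 : ℝ) t)).map fun s => X s.toNNReal ω

instance (X : ℝ≥0 → Ω → E) (t : ℝ≥0) (ω : Ω) : IsFiniteMeasure (occupationMeasure X t ω) :=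
  Measure.isFiniteMeasure_map _ _

omit [MetricSpace E] [SecondCountableTopology E] [BorelSpace E] in
theorem measurable_path (hX : Measurable (Function.uncurry X)) (ω : Ω) :
    Measurable fun s : ℝ => X s.toNNReal ω :=
  (measurable_process_prod hX).comp measurable_prodMk_left

omit [MetricSpace E] [SecondCountableTopology E] [BorelSpace E] in
theorem integral_occupationMeasure (hX : Measurable (Function.uncurry X)) {h : E → ℝ}
    (hh : Measurable h) (t : ℝ≥0) (ω : Ω) :
    ∫ x, h x ∂(occupationMeasure X t ω) = ∫ s in (0 : ℝ)..t, h (X s.toNNReal ω) := by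
  rw [occupationMeasure, integral_map (measurable_path hX ω).aemeasurable
    hh.aestronglyMeasurable, intervalIntegral.integral_of_le t.coe_nonneg]

omit [SecondCountableTopology E] in
-- Bounded pointwise limits lead from continuous functions to indicators of closed sets, and a π-λ
-- argument from closed to Borel sets.
theorem measurable_measure_of_measurable_integral {Γ : Ω → Measure E} [∀ ω, IsFiniteMeasure (Γ ω)]
    (huniv : Measurable fun ω => Γ ω univ)
    (hcont : ∀ h : E →ᵇ ℝ, Measurable fun ω => ∫ x, h x ∂(Γ ω)) : Measurable Γ := by
  have hdense : IsBpDense (univ : Set (E →ᵇ ℝ)) := fun h => subset_bpClosure _ ⟨h, trivial, rfl⟩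
  have hbp : ∀ v ∈ bpClosure ((fun g : E →ᵇ ℝ => (g : E → ℝ)) '' univ),
      Measurable fun ω => ∫ x, v x ∂(Γ ω) := by
    intro v hv
    refine (bpClosure_induction (p := fun v => Measurable fun ω => ∫ x, v x ∂(Γ ω))
      ?_ ?_ ?_ ?_ hv).2.2
    · rintro _ ⟨h, -, rfl⟩
      exact h.continuous.measurable
    · rintro _ ⟨h, -, rfl⟩
      exact ⟨‖h‖, h.norm_coe_le_norm⟩
    · rintro _ ⟨h, -, rfl⟩
      exact hcont h
    · intro u v K hu hv hK hvK hlim hm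
      refine measurable_of_tendsto_metrizable hm (tendsto_pi_nhds.2 fun ω => ?_)
      exact tendsto_integral_of_dominated_convergence (fun _ => K)
        (fun n => (hu n).aestronglyMeasurable) (integrable_const K)
        (fun n => Eventually.of_forall (hK n)) (Eventually.of_forall hlim)
  refine Measure.measurable_of_measurable_coe _ fun B hB => ?_
  induction B, hB using MeasurableSpace.induction_on_inter (s := {F : Set E | IsClosed F})
    (BorelSpace.measurable_eq.trans borel_eq_generateFrom_isClosed) isPiSystem_isClosed with
  | empty => simp
  | basic F hF =>
    have h1 := hbp _ (hdense.indicator_mem_bpClosure hF)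
    have h2 : ∀ ω, Γ ω F = ENNReal.ofReal (∫ x, F.indicator (fun _ => (1 : ℝ)) x ∂(Γ ω)) := by
      intro ω
      rw [integral_indicator_const _ (IsClosed.measurableSet hF)]
      simp
    simp_rw [h2]
    exact h1.ennreal_ofReal
  | compl B hB ih =>
    simp_rw [fun ω => measure_compl hB (measure_ne_top (Γ ω) B)]
    exact huniv.sub ih
  | iUnion f hd hf ih =>
    simp_rw [fun ω => measure_iUnion hd hf (μ := Γ ω)]
    exact Measurable.tsum ih

omit [SecondCountableTopology E] in
theorem measurable_occupationMeasure (hX : Measurable (Function.uncurry X)) (t : ℝ≥0) :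
    Measurable[starSigma X t] (occupationMeasure X t) := by
  refine @measurable_measure_of_measurable_integral E _ _ _ Ω (starSigma X t)
    (occupationMeasure X t) _ ?_ fun h => ?_
  · have huniv : ∀ ω, occupationMeasure X t ω univ = ENNReal.ofReal t := by
      intro ω
      rw [occupationMeasure, Measure.map_apply (measurable_path hX ω) MeasurableSet.univ]
      simp
    simp_rw [huniv]
    exact measurable_const
  · simp_rw [integral_occupationMeasure hX h.continuous.measurable]
    exact (comap_measurable _).mono
      ((le_iSup (fun h : E →ᵇ ℝ => MeasurableSpace.comap
        (fun ω => ∫ s in (0 : ℝ)..t, h (X s.toNNReal ω)) inferInstance) h).trans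
        (le_sup_right.trans (le_iSup₂_of_le t le_rfl le_rfl))) le_rfl

omit [SecondCountableTopology E] in
-- The σ-field contains by definition only integrals of `C_b` functions. These already make the
-- occupation measure a kernel, and integrating against a kernel handles every Borel `h`, bounded or
-- not.
theorem stronglyMeasurable_integral_process (hX : Measurable (Function.uncurry X)) {h : E → ℝ}
    (hh : Measurable h) (t : ℝ≥0) :
    StronglyMeasurable[starSigma X t] fun ω => ∫ s in (0 : ℝ)..t, h (X s.toNNReal ω) := by
  let Γ : @ProbabilityTheory.Kernel Ω E (starSigma X t) _ :=
    @ProbabilityTheory.Kernel.mk Ω E (starSigma X t) _ (occupationMeasure X t)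
      (measurable_occupationMeasure hX t)
  have h1 := @StronglyMeasurable.integral_kernel Ω E (starSigma X t) _ Γ _ _ _ h hh.stronglyMeasurable
  have h2 : (fun ω => ∫ s in (0 : ℝ)..t, h (X s.toNNReal ω)) = fun ω => ∫ x, h x ∂(Γ ω) :=
    funext fun ω => (integral_occupationMeasure hX hh t ω).symm
  rw [h2]
  exact h1

end OccupationMeasure

/-! ### Extending the test functions -/

section BpExtension

variable {E : Type*} [MetricSpace E] [SecondCountableTopology E] [MeasurableSpace E] [BorelSpace E]
variable {Ω : Type*} {mΩ : MeasurableSpace Ω} {P : Measure Ω}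

omit [MetricSpace E] [SecondCountableTopology E] [BorelSpace E] in
/-- A multiplicative family of test functions may be replaced by its bp-closure in an orthogonality
relation. -/
theorem integral_prod_mul_eq_zero_of_mem_bpClosure {W : Ω → ℝ} (hW : Integrable W P)
    {C : Set (E → ℝ)} (hCm : ∀ v ∈ C, Measurable v) (hCb : ∀ v ∈ C, ∃ K : ℝ, ∀ x, ‖v x‖ ≤ K)
    {k : ℕ} {Z : Fin k → Ω → E} (hZ : ∀ i, Measurable (Z i))
    (hC : ∀ g : Fin k → E → ℝ, (∀ i, g i ∈ C) → ∫ ω, (∏ i, g i (Z i ω)) * W ω ∂P = 0)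
    {g : Fin k → E → ℝ} (hg : ∀ i, g i ∈ bpClosure C) :
    ∫ ω, (∏ i, g i (Z i ω)) * W ω ∂P = 0 := by
  have hprop : ∀ v ∈ bpClosure C, Measurable v ∧ (∃ K : ℝ, ∀ x, ‖v x‖ ≤ K) := fun v hv =>
    have h := bpClosure_induction (p := fun _ => True) hCm hCb (fun _ _ => trivial)
      (fun _ _ _ _ _ _ _ _ _ => trivial) hv
    ⟨h.1, h.2.1⟩
  -- Slots are released one at a time: those in `J` range over the bp-closure, the others still over
  -- `C`.
  suffices H : ∀ (J : Finset (Fin k)) (g : Fin k → E → ℝ), (∀ i, g i ∈ bpClosure C) →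
      (∀ i ∉ J, g i ∈ C) → ∫ ω, (∏ i, g i (Z i ω)) * W ω ∂P = 0 from
    H Finset.univ g hg fun i hi => absurd (Finset.mem_univ i) hi
  intro J
  induction J using Finset.induction_on with
  | empty => exact fun g _ hgC => hC g fun i => hgC i (by simp)
  | insert a J ha ih =>
    intro g hg hgC
    have hpa := (bpClosure_induction (C := C) (v := g a) (p := fun v => v ∈ bpClosure C ∧
      ∫ ω, (∏ i, Function.update g a v i (Z i ω)) * W ω ∂P = 0) hCm hCb ?_ ?_ (hg a)).2.2.2
    · simpa using hpa
    · intro v hv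
      refine ⟨subset_bpClosure C hv, ih _ (fun i => ?_) fun i hi => ?_⟩
      · rcases eq_or_ne i a with rfl | hia
        · simpa using subset_bpClosure C hv
        · simpa [hia] using hg i
      · rcases eq_or_ne i a with rfl | hia
        · simpa using hv
        · simpa [hia] using hgC i (by simp [hia, hi])
    · intro u v K hu hv hK hvK hlim hpu
      refine ⟨mem_bpClosure_of_tendsto (fun n => (hpu n).1) hK hlim, ?_⟩
      choose B hB using fun i => (hprop _ (hg i)).2
      have hBu : ∀ n i x, ‖Function.update g a (u n) i x‖ ≤ Function.update B a K i := by
        intro n i x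
        rcases eq_or_ne i a with rfl | hia
        · simpa using hK n x
        · simpa [hia] using hB i x
      have hmu : ∀ n i, Measurable (Function.update g a (u n) i) := by
        intro n i
        rcases eq_or_ne i a with rfl | hia
        · simpa using hu n
        · simpa [hia] using (hprop _ (hg i)).1
      have ht : Tendsto (fun n => ∫ ω, (∏ i, Function.update g a (u n) i (Z i ω)) * W ω ∂P) atTop
          (𝓝 (∫ ω, (∏ i, Function.update g a v i (Z i ω)) * W ω ∂P)) := by
        refine tendsto_integral_of_dominated_convergence
          (fun ω => (∏ i, Function.update B a K i) * ‖W ω‖) (fun n => ?_) (hW.norm.const_mul _)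
          (fun n => Eventually.of_forall fun ω => ?_) (Eventually.of_forall fun ω => ?_)
        · exact (Finset.measurable_prod _ fun i _ =>
            (hmu n i).comp (hZ i)).aestronglyMeasurable.mul hW.aestronglyMeasurable
        · rw [norm_mul]
          exact mul_le_mul_of_nonneg_right (norm_prod_apply_le (hBu n) fun i => Z i ω)
            (norm_nonneg _)
        · refine Tendsto.mul_const _ (tendsto_finsetProd _ fun i _ => ?_)
          rcases eq_or_ne i a with rfl | hia
          · simpa using hlim (Z i ω)
          · simp [hia]
      simp_rw [fun n => (hpu n).2] at ht
      exact (tendsto_nhds_unique ht tendsto_const_nhds)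

end BpExtension

/-! ### Extending the domain functions and the events -/

section MartingaleIdentity

variable {E : Type*} [MetricSpace E] [SecondCountableTopology E] [MeasurableSpace E] [BorelSpace E]
variable {Ω : Type*} {mΩ : MeasurableSpace Ω} {P : Measure Ω} [IsFiniteMeasure P]
  {X : ℝ≥0 → Ω → E} {𝒟 : Set (E →ᵇ ℝ)} {A : 𝒟 → E → ℝ} {Φ : E → ℝ≥0} {𝒻 : Set 𝒟}

omit [MetricSpace E] [SecondCountableTopology E] [BorelSpace E] in
theorem integral_prod_process (hX : Measurable (Function.uncurry X)) (hΦ : Measurable Φ)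
    (hΦX : HasFiniteOccupation P X Φ) {h : E → ℝ} (hh : Measurable h) {C : ℝ}
    (hC : ∀ x, |h x| ≤ C * Φ x) {ξ : Ω → ℝ} (hξ : Measurable ξ) {c : ℝ} (hc : ∀ ω, ‖ξ ω‖ ≤ c)
    {s t : ℝ≥0} (hst : s ≤ t) :
    ∫ z, ξ z.1 * h (X z.2.toNNReal z.1) ∂(P.prod (volume.restrict (Ioc (s : ℝ) t))) =
      ∫ u in (s : ℝ)..t, (∫ ω, ξ ω * h (X u.toNNReal ω) ∂P) := by
  rw [integral_prod_symm _ (integrable_mul_process_prod hX hΦ hΦX hh hC hξ hc s t),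
    intervalIntegral.integral_of_le (NNReal.coe_le_coe.2 hst)]

omit [SecondCountableTopology E] [MeasurableSpace E] [BorelSpace E] in
-- Domination forces `A f = 0` where `Φ = 0`, so the convention for `Φ⁻¹` loses nothing.
theorem mul_graphPair_snd {f : 𝒟} {C : ℝ} (hC : ∀ x, |A f x| ≤ C * Φ x) (x : E) :
    (Φ x : ℝ) * (graphPair A Φ f x).2 = A f x := by
  rcases eq_or_ne (Φ x : ℝ) 0 with h | h
  · have h1 := hC x
    rw [h, mul_zero, abs_nonpos_iff] at h1
    rw [h, h1, zero_mul]
  · simp [graphPair, mul_inv_cancel_left₀ h]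

omit [SecondCountableTopology E] in
theorem measurable_graphPair (hA : ∀ f, Measurable (A f)) (hΦ : Measurable Φ) (f : 𝒟) :
    Measurable (graphPair A Φ f) :=
  (f : E →ᵇ ℝ).continuous.measurable.prodMk (hΦ.coe_nnreal_real.inv.mul (hA f))

omit [SecondCountableTopology E] [MeasurableSpace E] [BorelSpace E] in
theorem exists_norm_graphPair_le (hAΦ : IsDominated A Φ) (f : 𝒟) :
    ∃ K : ℝ, ∀ x, ‖graphPair A Φ f x‖ ≤ K := by
  obtain ⟨C, hC⟩ := hAΦ f
  refine ⟨max ‖(f : E →ᵇ ℝ)‖ |C|, fun x => ?_⟩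
  rw [Prod.norm_def]
  refine max_le_max ((f : E →ᵇ ℝ).norm_coe_le_norm x) ?_
  change ‖(Φ x : ℝ)⁻¹ * A f x‖ ≤ |C|
  rcases eq_or_ne (Φ x : ℝ) 0 with h | h
  · simp [h]
  · have hpos : (0 : ℝ) < Φ x := lt_of_le_of_ne (Φ x).coe_nonneg h.symm
    rw [norm_mul, norm_inv, Real.norm_of_nonneg hpos.le, inv_mul_le_iff₀ hpos, Real.norm_eq_abs,
      mul_comm]
    exact (hC x).trans (mul_le_mul_of_nonneg_right (le_abs_self C) hpos.le)

omit [SecondCountableTopology E] in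
/-- The integrated evolution equation passes to the bp-closure of the pairs `(f, Φ⁻¹ A f)`. -/
theorem evolution_eq_of_isBpGenerating (hX : Measurable (Function.uncurry X)) (hΦ : Measurable Φ)
    (hΦX : HasFiniteOccupation P X Φ) (hA : ∀ f, Measurable (A f)) (hAΦ : IsDominated A Φ)
    (h𝒻A : IsBpGenerating A Φ 𝒻) {ξ : Ω → ℝ} (hξ : Measurable ξ) {c : ℝ} (hc : ∀ ω, ‖ξ ω‖ ≤ c)
    {s t : ℝ≥0} (hst : s ≤ t)
    (h : ∀ f ∈ 𝒻, ∫ ω, ξ ω * (f : E →ᵇ ℝ) (X t ω) ∂P - ∫ ω, ξ ω * (f : E →ᵇ ℝ) (X s ω) ∂P =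
      ∫ u in (s : ℝ)..t, (∫ ω, ξ ω * A f (X u.toNNReal ω) ∂P)) (f : 𝒟) :
    ∫ ω, ξ ω * (f : E →ᵇ ℝ) (X t ω) ∂P - ∫ ω, ξ ω * (f : E →ᵇ ℝ) (X s ω) ∂P =
      ∫ u in (s : ℝ)..t, (∫ ω, ξ ω * A f (X u.toNNReal ω) ∂P) := by
  have hXt := measurable_process_apply hX
  have hXp := measurable_process_prod hX
  let ν : Measure (Ω × ℝ) := P.prod (volume.restrict (Ioc (s : ℝ) t))
  have hA' : ∀ f, ∫ z, ξ z.1 * ((Φ (X z.2.toNNReal z.1) : ℝ) *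
      (graphPair A Φ f (X z.2.toNNReal z.1)).2) ∂ν =
      ∫ u in (s : ℝ)..t, (∫ ω, ξ ω * A f (X u.toNNReal ω) ∂P) := by
    intro f
    obtain ⟨C, hC⟩ := hAΦ f
    rw [← integral_prod_process hX hΦ hΦX (hA f) hC hξ hc hst]
    simp_rw [mul_graphPair_snd hC]
    rfl
  have hΦν : Integrable (fun z : Ω × ℝ => (Φ (X z.2.toNNReal z.1) : ℝ)) ν := by
    simpa using integrable_mul_process_prod (C := 1) (ξ := fun _ => 1) (c := 1) hX hΦ hΦX
      hΦ.coe_nnreal_real (fun x => by simp) measurable_const (by simp) s t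
  have hmem : graphPair A Φ f ∈ bpClosure (graphPair A Φ '' 𝒻) := h𝒻A (mem_range_self f)
  -- Restoring the factor `Φ` makes both sides meaningful for arbitrary bounded pairs, and a
  -- multiple of `Φ` dominates the second components.
  have hbp := bpClosure_induction (p := fun p : E → ℝ × ℝ =>
    ∫ ω, ξ ω * (p (X t ω)).1 ∂P - ∫ ω, ξ ω * (p (X s ω)).1 ∂P =
      ∫ z, ξ z.1 * ((Φ (X z.2.toNNReal z.1) : ℝ) * (p (X z.2.toNNReal z.1)).2) ∂ν)
    (by rintro _ ⟨f, -, rfl⟩; exact measurable_graphPair hA hΦ f)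
    (by rintro _ ⟨f, -, rfl⟩; exact exists_norm_graphPair_le hAΦ f)
    (by
      rintro _ ⟨f, hf, rfl⟩
      rw [hA']
      exact h f hf) ?_ hmem
  · rw [← hA' f]
    exact hbp.2.2
  · intro u v K hu hv hK hvK hlim hpu
    have h1 : ∀ r, Tendsto (fun n => ∫ ω, ξ ω * (u n (X r ω)).1 ∂P) atTop
        (𝓝 (∫ ω, ξ ω * (v (X r ω)).1 ∂P)) := by
      intro r
      refine tendsto_integral_of_dominated_convergence (fun _ => c * K)
        (fun n => (hξ.mul ((hu n).fst.comp (hXt r))).aestronglyMeasurable) (integrable_const _)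
        (fun n => Eventually.of_forall fun ω => ?_) (Eventually.of_forall fun ω => ?_)
      · rw [norm_mul]
        exact mul_le_mul (hc ω) ((norm_fst_le _).trans (hK n _)) (norm_nonneg _)
          ((norm_nonneg _).trans (hc ω))
      · exact ((continuous_fst.tendsto _).comp (hlim _)).const_mul _
    have h2 : Tendsto (fun n => ∫ z, ξ z.1 * ((Φ (X z.2.toNNReal z.1) : ℝ) *
        (u n (X z.2.toNNReal z.1)).2) ∂ν) atTop
        (𝓝 (∫ z, ξ z.1 * ((Φ (X z.2.toNNReal z.1) : ℝ) * (v (X z.2.toNNReal z.1)).2) ∂ν)) := by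
      refine tendsto_integral_of_dominated_convergence
        (fun z => c * ((Φ (X z.2.toNNReal z.1) : ℝ) * K))
        (fun n => ((hξ.comp measurable_fst).mul ((hΦ.comp hXp).coe_nnreal_real.mul
          ((hu n).snd.comp hXp))).aestronglyMeasurable) ((hΦν.mul_const K).const_mul c)
        (fun n => Eventually.of_forall fun z => ?_) (Eventually.of_forall fun z => ?_)
      · rw [norm_mul, norm_mul, Real.norm_of_nonneg (NNReal.coe_nonneg _)]
        exact mul_le_mul (hc _) (mul_le_mul_of_nonneg_left ((norm_snd_le _).trans (hK n _))
          (NNReal.coe_nonneg _)) (by positivity) ((norm_nonneg _).trans (hc z.1))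
      · exact (((continuous_snd.tendsto _).comp (hlim _)).const_mul _).const_mul _
    have h3 := (h1 t).sub (h1 s)
    simp_rw [hpu] at h3
    exact tendsto_nhds_unique h3 h2

/-- The σ-field generated by the values of `X` at rational times up to `s`. -/
abbrev ratSigma (X : ℝ≥0 → Ω → E) (s : ℝ≥0) : MeasurableSpace Ω :=
  ⨆ (q : ℚ≥0) (_ : (q : ℝ≥0) ≤ s), MeasurableSpace.comap (X q) inferInstance

omit [MetricSpace E] [SecondCountableTopology E] [BorelSpace E] in
theorem ratSigma_mono (X : ℝ≥0 → Ω → E) {s t : ℝ≥0} (hst : s ≤ t) : ratSigma X s ≤ ratSigma X t :=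
  iSup₂_le fun q hq => le_iSup₂_of_le (f := fun (q : ℚ≥0) (_ : (q : ℝ≥0) ≤ t) =>
    MeasurableSpace.comap (X q) inferInstance) q (hq.trans hst) le_rfl

omit [MetricSpace E] [SecondCountableTopology E] [BorelSpace E] in
theorem ratSigma_le (hX : ∀ t, Measurable (X t)) (s : ℝ≥0) : ratSigma X s ≤ mΩ :=
  iSup₂_le fun q _ => (hX q).comap_le

omit [SecondCountableTopology E] [IsFiniteMeasure P] in
-- Finite intersections of closed cylinders form a generating π-system, and the events over which
-- `W` integrates to zero form a λ-system.
theorem setIntegral_eq_zero_of_ratSigma (hX : ∀ t, Measurable (X t)) {s : ℝ≥0} {W : Ω → ℝ}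
    (hW : Integrable W P)
    (h : ∀ (k : ℕ), 1 ≤ k → ∀ (r : Fin k → ℚ≥0), (∀ i, (r i : ℝ≥0) ≤ s) →
      ∀ F : Fin k → Set E, (∀ i, IsClosed (F i)) → ∫ ω in ⋂ i, X (r i) ⁻¹' F i, W ω ∂P = 0)
    {B : Set Ω} (hB : MeasurableSet[ratSigma X s] B) : ∫ ω in B, W ω ∂P = 0 := by
  let π : ℚ≥0 → Set (Set Ω) := fun q => (X q ⁻¹' ·) '' {F : Set E | IsClosed F}
  let S : Set ℚ≥0 := {q | (q : ℝ≥0) ≤ s}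
  have hπ : ∀ q, IsPiSystem (π q) := fun q => isPiSystem_isClosed.comap (X q)
  have hle : ratSigma X s ≤ MeasurableSpace.generateFrom (piiUnionInter π S) := by
    refine iSup₂_le fun q hq => ?_
    rw [BorelSpace.measurable_eq (α := E), borel_eq_generateFrom_isClosed,
      MeasurableSpace.comap_generateFrom]
    exact MeasurableSpace.generateFrom_mono (subset_piiUnionInter (π := π) (S := S) (show q ∈ S from hq))
  have hbasic : ∀ B ∈ piiUnionInter π S, MeasurableSet B ∧ ∫ ω in B, W ω ∂P = 0 := by
    rintro _ ⟨T, hT, f, hf, rfl⟩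
    choose! F hF hFf using hf
    -- A vacuous constraint at time `0` is prepended so that `1 ≤ k` even for empty `T`; that case
    -- gives the total integral.
    have hset : ⋂ x ∈ T, f x = ⋂ i : Fin (T.card + 1),
        X ((Fin.cons 0 (fun j => (T.equivFin.symm j : ℚ≥0)) : Fin (T.card + 1) → ℚ≥0) i) ⁻¹'
          (Fin.cons univ (fun j => F (T.equivFin.symm j)) : Fin (T.card + 1) → Set E) i := by
      ext ω
      simp only [mem_iInter, Fin.forall_fin_succ, Fin.cons_zero, Fin.cons_succ, preimage_univ,
        mem_univ, true_and]
      constructor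
      · intro hω j
        have h1 := hω _ (T.equivFin.symm j).2
        rwa [← hFf _ (T.equivFin.symm j).2] at h1
      · intro hω q hq
        have h1 := hω (T.equivFin ⟨q, hq⟩)
        rw [Equiv.symm_apply_apply] at h1
        rw [← hFf q hq]
        exact h1
    have hc : ∀ i, IsClosed ((Fin.cons univ (fun j => F (T.equivFin.symm j)) :
        Fin (T.card + 1) → Set E) i) := by
      refine Fin.cases ?_ fun j => ?_
      · simp
      · simpa using hF _ (T.equivFin.symm j).2
    rw [hset]
    refine ⟨MeasurableSet.iInter fun i => hX _ (hc i).measurableSet,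
      h _ (Nat.le_add_left 1 _) _ ?_ _ hc⟩
    refine Fin.cases ?_ fun j => ?_
    · simp
    · exact hT (T.equivFin.symm j).2
  have huniv : ∫ ω, W ω ∂P = 0 := by
    have h1 := (hbasic univ ⟨∅, by simp, fun _ => univ, by simp, by simp⟩).2
    rwa [setIntegral_univ] at h1
  refine (MeasurableSpace.induction_on_inter
    (C := fun B _ => MeasurableSet B ∧ ∫ ω in B, W ω ∂P = 0)
    rfl (isPiSystem_piiUnionInter π hπ S) (by simp) hbasic ?_ ?_ B (hle B hB)).2
  · rintro B - ⟨hB, hB0⟩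
    refine ⟨hB.compl, ?_⟩
    have h1 := integral_add_compl hB hW
    rwa [hB0, huniv, zero_add] at h1
  · intro F hd _ hF
    refine ⟨MeasurableSet.iUnion fun i => (hF i).1, ?_⟩
    rw [integral_iUnion (fun i => (hF i).1) hd hW.integrableOn]
    simp [fun i => (hF i).2]

end MartingaleIdentity

/-! ### The martingale property -/

section MartingaleProperty

variable {E : Type*} [MetricSpace E] [SecondCountableTopology E] [MeasurableSpace E] [BorelSpace E]
variable {Ω : Type*} {mΩ : MeasurableSpace Ω} {P : Measure Ω} [IsFiniteMeasure P]
  {X : ℝ≥0 → Ω → E} {𝒟 : Set (E →ᵇ ℝ)} {A : 𝒟 → E → ℝ} {Φ : E → ℝ≥0} {𝒻 : Set 𝒟}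
  {𝒢 : Set (E →ᵇ ℝ)} {μ : ConsistentFamilies E}

theorem HasFiniteDimLaws.hasFiniteOccupation (hμX : HasFiniteDimLaws P X μ)
    (hX : Measurable (Function.uncurry X)) (hΦ : Measurable Φ) (hμ : μ ∈ solutionLaws A Φ 𝒻 𝒢) :
    HasFiniteOccupation P X Φ := by
  intro T
  obtain ⟨N, hN⟩ := exists_nat_ge T
  rw [← hμX.lintegral_occupation hX hΦ]
  refine (lintegral_mono_set (Ioc_subset_Ioc_right ?_)).trans_lt (hμ.1 N)
  exact_mod_cast hN

theorem setIntegral_martingalePart_sub_ratCast (hμX : HasFiniteDimLaws P X μ)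
    (hX : Measurable (Function.uncurry X)) (hA : ∀ f, Measurable (A f)) (hΦ : Measurable Φ)
    (hAΦ : IsDominated A Φ) (h𝒻A : IsBpGenerating A Φ 𝒻) (h𝒢 : IsBpDense 𝒢)
    (hμ : μ ∈ solutionLaws A Φ 𝒻 𝒢) (f : 𝒟) {s t : ℚ≥0} (hst : s ≤ t) {B : Set Ω}
    (hB : MeasurableSet[ratSigma X s] B) :
    ∫ ω in B, (((f : E →ᵇ ℝ) (X t ω) - ∫ u in (0 : ℝ)..(t : ℝ≥0), A f (X u.toNNReal ω)) -
      ((f : E →ᵇ ℝ) (X s ω) - ∫ u in (0 : ℝ)..(s : ℝ≥0), A f (X u.toNNReal ω))) ∂P = 0 := by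
  have hXt := measurable_process_apply hX
  have hΦX := hμX.hasFiniteOccupation hX hΦ hμ
  have hst' : (s : ℝ≥0) ≤ t := by exact_mod_cast hst
  obtain ⟨C, hC⟩ := hAΦ f
  have hM := integrable_martingalePart hX hΦ hΦX (hA f) hC
    (f : E →ᵇ ℝ).continuous.measurable (f : E →ᵇ ℝ).norm_coe_le_norm
  have hW := (hM t).sub (hM s)
  refine setIntegral_eq_zero_of_ratSigma hXt hW (fun k hk r hr F hF => ?_) hB
  have hprod : ∀ g : Fin k → E → ℝ,
      (∀ i, g i ∈ bpClosure ((fun g : E →ᵇ ℝ => (g : E → ℝ)) '' 𝒢)) →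
      ∫ ω, (∏ i, g i (X (r i) ω)) *
        (((f : E →ᵇ ℝ) (X t ω) - ∫ u in (0 : ℝ)..(t : ℝ≥0), A f (X u.toNNReal ω)) -
        ((f : E →ᵇ ℝ) (X s ω) - ∫ u in (0 : ℝ)..(s : ℝ≥0), A f (X u.toNNReal ω))) ∂P = 0 := by
    intro g hg
    refine integral_prod_mul_eq_zero_of_mem_bpClosure hW ?_ ?_ (fun i => hXt (r i)) ?_ hg
    · rintro _ ⟨g, -, rfl⟩
      exact g.continuous.measurable
    · rintro _ ⟨g, -, rfl⟩
      exact ⟨‖g‖, g.norm_coe_le_norm⟩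
    · intro g hg
      choose G hG hGg using hg
      obtain rfl : (fun i => (G i : E → ℝ)) = g := funext hGg
      have hξ : Measurable fun ω => ∏ i, G i (X (r i) ω) :=
        measurable_prod_process (fun i => (G i).continuous.measurable) fun i => hXt (r i)
      have hc : ∀ ω, ‖∏ i, G i (X (r i) ω)‖ ≤ ∏ i, ‖G i‖ := fun ω =>
        norm_prod_apply_le (g := fun i => (G i : E → ℝ)) (fun i => (G i).norm_coe_le_norm)
          fun i => X (r i) ω
      have hev := evolution_eq_of_isBpGenerating hX hΦ hΦX hA hAΦ h𝒻A hξ hc hst'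
        (fun f' hf' => by
          have h1 := hμ.2 k hk G hG f' hf' r s t (fun i => by exact_mod_cast hr i) hst
          rw [hμX.integral_tensorFun hXt G (f' : E →ᵇ ℝ).continuous.measurable,
            hμX.integral_tensorFun hXt G (f' : E →ᵇ ℝ).continuous.measurable] at h1
          simp_rw [hμX.integral_tensorFun hXt G (hA f')] at h1
          exact h1) f
      have h2 := integral_mul_martingalePart_sub hX hΦ hΦX (hA f) hC
        (f : E →ᵇ ℝ).continuous.measurable (f : E →ᵇ ℝ).norm_coe_le_norm hξ hc hst'
      rw [hev, sub_self, ← integral_sub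
        ((hM t).bdd_mul hξ.aestronglyMeasurable (Eventually.of_forall hc))
        ((hM s).bdd_mul hξ.aestronglyMeasurable (Eventually.of_forall hc))] at h2
      simp_rw [← mul_sub] at h2
      exact h2
  have h1 := hprod (fun i => (F i).indicator fun _ => 1)
    fun i => h𝒢.indicator_mem_bpClosure (hF i)
  rw [← integral_indicator (MeasurableSet.iInter fun i => hXt _ (hF i).measurableSet)]
  refine (integral_congr_ae (Eventually.of_forall fun ω => ?_)).trans h1
  by_cases hω : ω ∈ ⋂ i, X (r i) ⁻¹' F i
  · have h2 : ∀ i, X (r i) ω ∈ F i := fun i => mem_iInter.1 hω i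
    have h3 : ∏ i, (F i).indicator (fun _ => (1 : ℝ)) (X (r i) ω) = 1 :=
      Finset.prod_eq_one fun i _ => indicator_of_mem (h2 i) _
    refine (indicator_of_mem hω _).trans ?_
    rw [h3, one_mul]
    rfl
  · obtain ⟨i, hi⟩ : ∃ i, X (r i) ω ∉ F i := by
      simpa using hω
    have h2 : ∏ i, (F i).indicator (fun _ => (1 : ℝ)) (X (r i) ω) = 0 :=
      Finset.prod_eq_zero (Finset.mem_univ i) (indicator_of_notMem hi _)
    simp only [indicator_of_notMem hω, h2, zero_mul]

/-- Real times are approximated by rationals from above, so that an event determined by time `s` is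
still allowed at the approximating times. -/
theorem setIntegral_martingalePart_eq (hμX : HasFiniteDimLaws P X μ)
    (hX : Measurable (Function.uncurry X)) (hcX : IsContinuousInProbability P X)
    (hA : ∀ f, Measurable (A f)) (hΦ : Measurable Φ)
    (hAΦ : IsDominated A Φ) (h𝒻A : IsBpGenerating A Φ 𝒻) (h𝒢 : IsBpDense 𝒢)
    (hμ : μ ∈ solutionLaws A Φ 𝒻 𝒢) (f : 𝒟) {s t : ℝ≥0} (hst : s ≤ t) {B : Set Ω}
    (hB : MeasurableSet[ratSigma X s] B) :
    ∫ ω in B, ((f : E →ᵇ ℝ) (X t ω) - ∫ u in (0 : ℝ)..t, A f (X u.toNNReal ω)) ∂P =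
      ∫ ω in B, ((f : E →ᵇ ℝ) (X s ω) - ∫ u in (0 : ℝ)..s, A f (X u.toNNReal ω)) ∂P := by
  have hXt := measurable_process_apply hX
  have hΦX := hμX.hasFiniteOccupation hX hΦ hμ
  obtain ⟨C, hC⟩ := hAΦ f
  have hM := integrable_martingalePart hX hΦ hΦX (hA f) hC
    (f : E →ᵇ ℝ).continuous.measurable (f : E →ᵇ ℝ).norm_coe_le_norm
  have hBm : MeasurableSet B := ratSigma_le hXt s B hB
  let ξ : Ω → ℝ := B.indicator 1
  have hξ : Measurable ξ := measurable_one.indicator hBm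
  have hc : ∀ ω, ‖ξ ω‖ ≤ 1 := fun ω =>
    (norm_indicator_le_norm_self _ _).trans (by simp)
  have hξmul : ∀ Y : Ω → ℝ, ∫ ω, ξ ω * Y ω ∂P = ∫ ω in B, Y ω ∂P := by
    intro Y
    rw [← integral_indicator hBm]
    refine integral_congr_ae (Eventually.of_forall fun ω => ?_)
    by_cases hω : ω ∈ B <;> simp [ξ, hω]
  -- The next grid point: strictly above `r`, monotone in `r`, and convergent to `r`.
  let q : ℕ → ℝ≥0 → ℚ≥0 := fun n r => ratFloor n r + 1 / n.factorial
  have hq : ∀ n r, ((q n r : ℚ≥0) : ℝ≥0) = (ratFloor n r : ℝ≥0) + 1 / n.factorial := by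
    intro n r
    simp only [q]
    push_cast
    rfl
  have hqlim : ∀ r, Tendsto (fun n => (q n r : ℝ≥0)) atTop (𝓝 r) := by
    intro r
    simp_rw [hq]
    simpa using (tendsto_ratFloor r).add tendsto_one_div_factorial
  have hqle : ∀ n, (q n s : ℝ≥0) ≤ q n t := fun n => by
    rw [hq, hq]
    have := ratFloor_mono n hst
    gcongr
  have hsq : ∀ n, s ≤ q n s := fun n => by
    rw [hq]
    exact (lt_ratFloor_add n s).le
  let φ : ℝ → ℝ := fun u => ∫ ω, ξ ω * A f (X u.toNNReal ω) ∂P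
  have hφ : ∀ T : ℝ≥0, IntegrableOn φ (Icc 0 T) := fun T => by
    rw [integrableOn_Icc_iff_integrableOn_Ioc]
    exact (integrable_mul_process_prod hX hΦ hΦX (hA f) hC hξ hc 0 T).integral_prod_right
  -- After Fubini the drift is a primitive of the integrable `φ`, hence continuous in time, and only
  -- `f(X)` requires continuity in probability.
  have hD : ∀ r v : ℝ≥0, r ≤ v →
      ∫ ω in B, ((f : E →ᵇ ℝ) (X v ω) - ∫ u in (0 : ℝ)..v, A f (X u.toNNReal ω)) ∂P -
      ∫ ω in B, ((f : E →ᵇ ℝ) (X r ω) - ∫ u in (0 : ℝ)..r, A f (X u.toNNReal ω)) ∂P =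
      (∫ ω in B, (f : E →ᵇ ℝ) (X v ω) ∂P - ∫ u in (0 : ℝ)..v, φ u) -
        (∫ ω in B, (f : E →ᵇ ℝ) (X r ω) ∂P - ∫ u in (0 : ℝ)..r, φ u) := by
    intro r v hrv
    have h1 := integral_mul_martingalePart_sub hX hΦ hΦX (hA f) hC
        (f : E →ᵇ ℝ).continuous.measurable (f : E →ᵇ ℝ).norm_coe_le_norm hξ hc hrv
    have hi : ∀ w : ℝ≥0, IntervalIntegrable φ volume 0 w := fun w => by
      rw [intervalIntegrable_iff_integrableOn_Icc_of_le w.coe_nonneg]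
      exact hφ w
    have h2 := intervalIntegral.integral_interval_sub_left (hi v) (hi r)
    simp only [hξmul] at h1
    rw [h1]
    simp only [φ, hξmul] at h2 ⊢
    rw [← h2]
    ring
  have hlim : ∀ r : ℝ≥0, Tendsto
      (fun n => ∫ ω in B, (f : E →ᵇ ℝ) (X (q n r) ω) ∂P - ∫ u in (0 : ℝ)..(q n r : ℝ≥0), φ u)
      atTop (𝓝 (∫ ω in B, (f : E →ᵇ ℝ) (X r ω) ∂P - ∫ u in (0 : ℝ)..r, φ u)) := by
    intro r
    refine Tendsto.sub ?_ ?_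
    · refine tendsto_integral_of_tendstoInMeasure (fun n => hXt _) (fun ε hε => ?_) f
      have h1 := (hcX r).comp (hqlim r) ε hε
      exact tendsto_of_tendsto_of_tendsto_of_le_of_le tendsto_const_nhds h1
        (fun _ => zero_le) fun n => Measure.restrict_apply_le _ _
    · have hcont : ContinuousOn (fun x : ℝ => ∫ u in (0 : ℝ)..x, φ u)
          (uIcc 0 ((r + 1 : ℝ≥0) : ℝ)) := by
        refine intervalIntegral.continuousOn_primitive_interval ?_
        rw [uIcc_of_le (NNReal.coe_nonneg _)]
        exact hφ _
      rw [uIcc_of_le (NNReal.coe_nonneg _)] at hcont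
      have hrm : (r : ℝ) ∈ Icc 0 ((r + 1 : ℝ≥0) : ℝ) := by
        refine ⟨r.coe_nonneg, ?_⟩
        push_cast
        linarith
      refine (hcont r hrm).tendsto.comp (tendsto_nhdsWithin_iff.2
        ⟨NNReal.tendsto_coe.2 (hqlim r), ?_⟩)
      filter_upwards [(hqlim r).eventually_le_const (lt_add_one r)] with n hn
      exact ⟨NNReal.coe_nonneg _, NNReal.coe_le_coe.2 hn⟩
  rw [← sub_eq_zero, hD s t hst]
  refine tendsto_nhds_unique ((hlim t).sub (hlim s)) (tendsto_const_nhds.congr fun n => ?_)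
  rw [← hD _ _ (hqle n), ← integral_sub (hM _).integrableOn (hM _).integrableOn]
  exact (setIntegral_martingalePart_sub_ratCast hμX hX hA hΦ hAΦ h𝒻A h𝒢 hμ f
    (by exact_mod_cast hqle n) (ratSigma_mono X (hsq n) B hB)).symm

/-- The identities control only events of the rational σ-field; `hσ` carries them over to `*ℱ^X_s`.
-/
theorem isSolution_of_mem_solutionLaws [IsProbabilityMeasure P] (hμX : HasFiniteDimLaws P X μ)
    (hX : Measurable (Function.uncurry X)) (hcX : IsContinuousInProbability P X)
    (hσ : ∀ s, starSigma X s ≤ ratSigma X s)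
    (hA : ∀ f, Measurable (A f)) (hΦ : Measurable Φ)
    (hAΦ : IsDominated A Φ) (h𝒻A : IsBpGenerating A Φ 𝒻) (h𝒢 : IsBpDense 𝒢)
    (hμ : μ ∈ solutionLaws A Φ 𝒻 𝒢) : IsSolution A Φ P X := by
  have hXt := measurable_process_apply hX
  have hΦX := hμX.hasFiniteOccupation hX hΦ hμ
  refine ⟨⟨P.map (X 0), Measure.isProbabilityMeasure_map (hXt 0).aemeasurable⟩, hX, rfl, hΦX,
    fun f => ?_⟩
  obtain ⟨C, hC⟩ := hAΦ f
  have hM := integrable_martingalePart hX hΦ hΦX (hA f) hC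
    (f : E →ᵇ ℝ).continuous.measurable (f : E →ᵇ ℝ).norm_coe_le_norm
  have hadapt : ∀ t, StronglyMeasurable[starSigma X t] fun ω =>
      (f : E →ᵇ ℝ) (X t ω) - ∫ u in (0 : ℝ)..t, A f (X u.toNNReal ω) := fun t =>
    (((f : E →ᵇ ℝ).continuous.measurable.comp
      (measurable_starSigma_apply le_rfl)).stronglyMeasurable).sub
        (stronglyMeasurable_integral_process hX (hA f) t)
  refine ⟨hadapt, fun s t hst => ?_⟩
  refine (ae_eq_condExp_of_forall_setIntegral_eq ((starFiltration X hX).le s) (hM t)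
    (fun B _ _ => (hM s).integrableOn) (fun B hB _ => ?_) (hadapt s).aestronglyMeasurable).symm
  exact (setIntegral_martingalePart_eq hμX hX hcX hA hΦ hAΦ h𝒻A h𝒢 hμ f hst (hσ s B hB)).symm

end MartingaleProperty

/-! ### The theorem -/

theorem theorem3p1 {E : Type*} [MetricSpace E] [CompleteSpace E] [SecondCountableTopology E]
    [MeasurableSpace E] [BorelSpace E]
    (𝒟 : Set (E →ᵇ ℝ)) (A : 𝒟 → E → ℝ) (hA : ∀ f, Measurable (A f))
    (Φ : E → ℝ≥0) (hΦ : Measurable Φ) (hAΦ : IsDominated A Φ)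
    (𝒻 : Set 𝒟) (h𝒻 : 𝒻.Countable) (h𝒻A : IsBpGenerating A Φ 𝒻) :
    PolishSpace (ConsistentFamilies E) ∧
    (∃ 𝒢 : Set (E →ᵇ ℝ), 𝒢.Countable ∧ IsBpDense 𝒢) ∧
    ∀ 𝒢 : Set (E →ᵇ ℝ), 𝒢.Countable → IsBpDense 𝒢 →
      MeasurableSet[borel (ConsistentFamilies E)] (solutionLaws A Φ 𝒻 𝒢) ∧
      @StandardBorelSpace (solutionLaws A Φ 𝒻 𝒢) (borel (solutionLaws A Φ 𝒻 𝒢)) ∧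
      (∀ μ : ConsistentFamilies E, μ ∈ solutionLaws A Φ 𝒻 𝒢 ↔
        ∃ (Ω : Type*) (_ : MeasurableSpace Ω) (P : Measure Ω) (X : ℝ≥0 → Ω → E),
          IsProbabilityMeasure P ∧ IsContinuousInProbability P X ∧
            HasFiniteDimLaws P X μ ∧ IsSolution A Φ P X) ∧
      (∀ (Ω : Type*) (_ : MeasurableSpace Ω) (P : Measure Ω) (X : ℝ≥0 → Ω → E),
        IsProbabilityMeasure P → IsContinuousInProbability P X → IsSolution A Φ P X →
          ∃ μ ∈ solutionLaws A Φ 𝒻 𝒢, HasFiniteDimLaws P X μ) := by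
  have hPolish := polishSpace_consistentFamilies E
  refine ⟨hPolish, exists_countable_isBpDense E, fun 𝒢 h𝒢c h𝒢 => ?_⟩
  have hmeas := measurableSet_solutionLaws hA hΦ h𝒻 h𝒢c
  refine ⟨hmeas, standardBorelSpace_of_measurableSet_borel hmeas, fun μ => ⟨fun hμ => ?_, ?_⟩, ?_⟩
  · obtain ⟨Ω, mΩ, P, X, hP, hX, hcX, hμX, hσ⟩ := exists_progressive_process μ
    exact ⟨Ω, mΩ, P, X, hP, hcX, hμX,
      isSolution_of_mem_solutionLaws hμX hX hcX hσ hA hΦ hAΦ h𝒻A h𝒢 hμ⟩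
  · rintro ⟨Ω, mΩ, P, X, hP, -, hμX, hsol⟩
    exact hsol.mem_solutionLaws hA hΦ hAΦ hμX 𝒻 𝒢
  · intro Ω mΩ P X hP hcX hsol
    obtain ⟨μ, hμX⟩ := exists_hasFiniteDimLaws
      (fun t => measurable_process_apply hsol.choose_spec.measurable t) hcX
    exact ⟨μ, hsol.mem_solutionLaws hA hΦ hAΦ hμX 𝒻 𝒢, hμX⟩

end
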